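/- Let $G$ be a finite, compact, connected metric graph: finitely many edges $I_j=[0,L_j]$ with $L_j>0$, $j=1,\dots,r$, whose endpoints are partitioned into classes $v_1,\dots,v_s$, called vertices; $o(I_j)$ and $t(I_j)$ denote the vertices containing the endpoints $0$ and $L_j$ of $I_j$ (loops and multiple edges are allowed). The degree of a vertex is the number of endpoints in it, and $\partial G$ is the set of vertices of degree one. A function $f$ on $G$ is a family of functions $f_j:I_j\to\mathbb C$; it is continuous on $G$ if all $f_j$ are continuous and the values at endpoints belonging to the same vertex $v$ coincide, the common value being $f(v)$. Put $L^2(G)=\bigoplus_j L^2(I_j)$, and let $AC^2(G)$ be the set of $f$ for which all $f_j$ and $f_j'$ are absolutely continuous. Let $q_j\in L^1(I_j)$ be real-valued, $(\mathcal L f)_j=-f_j''+q_jf_j$, $\alpha\in\mathbb R^s$, and $$\partial_\nu f(v)=\sum_{t(I_j)=v}f_j'(L_j)-\sum_{o(I_j)=v}f_j'(0).$$ Let $A_\alpha$ be the operator in $L^2(G)$ with $A_\alpha f=\mathcal L f$ whose domain consists of all $f\in L^2(G)\cap AC^2(G)$ such that $\mathcal L f\in L^2(G)$, $f$ is continuous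 on $G$, and $\partial_\nu f(v_i)-\alpha_i f(v_i)=0$ for $i=1,\dots,s$. Assume that $\operatorname{cyc}(G):=1+r-s\ge 1$ and that $B=\partial G=\{v_{i_1},\dots,v_{i_m}\}$ is nonempty. For $\mu\in\mathbb C\setminus\sigma(A_\alpha)$ let $M_{B,\alpha}(\mu)\in\mathbb C^{m\times m}$ be the Titchmarsh--Weyl matrix, with entries $(M_{B,\alpha}(\mu))_{k,l}=f^{(l)}(v_{i_k})$, where $f^{(l)}\in L^2(G)\cap AC^2(G)$ is the unique solution of $\mathcal L f^{(l)}=\mu f^{(l)}$ that is continuous on $G$ and satisfies $\partial_\nu f^{(l)}(v_{i_l})-\alpha_{i_l}f^{(l)}(v_{i_l})=1$ and $\partial_\nu f^{(l)}(v_i)-\alpha_i f^{(l)}(v_i)=0$ for all $i\ne i_l$. Let $\operatorname{Res}_\lambda M_{B,\alpha}$ denote the residue of the matrix function $M_{B,\alpha}$ at $\lambda$, that is, $\frac1{2\pi i}\oint M_{B,\alpha}(\mu)\,d\mu$ over all sufficiently small circles around $\lambda$; it is $0$ if $M_{B,\alpha}$ is analytic at $\lambda$ or can be continued analytically into $\lambda$.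 A pole is a pole of order at least one. Then for each $\lambda\in\mathbb R$ the space $\ker(A_\alpha-\lambda)$ is finite-dimensional, $M_{B,\alpha}$ is defined and analytic in a punctured neighbourhood of $\lambda$, and the following hold. (i) If $\lambda$ is a pole of $M_{B,\alpha}$, then $\lambda$ is an eigenvalue of $A_\alpha$. (ii) If $\lambda$ is an eigenvalue of $A_\alpha$ with $\dim\ker(A_\alpha-\lambda)>2\operatorname{cyc}(G)-1$, then $\lambda$ is a pole of $M_{B,\alpha}$. (iii) $\operatorname{rank}\operatorname{Res}_\lambda M_{B,\alpha}\le\dim\ker(A_\alpha-\lambda)\le\operatorname{rank}\operatorname{Res}_\lambda M_{B,\alpha}+2\operatorname{cyc}(G)-1$. -/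

import Mathlib

open Set Filter Topology MeasureTheory

/-- A finite compact metric graph with vertex set `V` and edge set `E`. The edge `e` is the interval
`[0, length e]`, its endpoint `0` lies at the vertex `o e` and its endpoint `length e` lies at the
vertex `t e`. Loops and multiple edges are allowed. Vertices are classes of endpoints of edges, so
each of them carries at least one endpoint. -/
structure MetricGraph (V E : Type*) where
  length : E → ℝ
  length_pos : ∀ e, 0 < length e
  o : E → V
  t : E → V
  exists_endpoint : ∀ v, ∃ p : E × Bool, (if p.2 then t p.1 else o p.1) = v

namespace MetricGraph

noncomputable section

variable {V E : Type*} (G : MetricGraph V E)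

/-- The compact interval `[0, L_e]`. -/
def interval (e : E) : Set ℝ := Icc 0 (G.length e)

/-- The vertex at which an endpoint of an edge lies: `(e, false)` is the endpoint `0` of `e` and
`(e, true)` is the endpoint `L_e`. -/
def vertexOf (p : E × Bool) : V := if p.2 then G.t p.1 else G.o p.1

/-- The value of a function on the graph at an endpoint of an edge. -/
def endpointValue (f : E → ℝ → ℂ) (p : E × Bool) : ℂ :=
  f p.1 (if p.2 then G.length p.1 else 0)

/-- The degree of a vertex: the number of endpoints of edges in it (a loop counts twice). -/
def degree (v : V) : ℕ := Nat.card {p : E × Bool // G.vertexOf p = v}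

open Classical in
/-- The boundary: the vertices of degree one. -/
def boundary [Fintype V] : Finset V := Finset.univ.filter fun v => G.degree v = 1

/-- Connectedness of the graph. -/
def IsConnected : Prop :=
  (SimpleGraph.fromRel fun v w => ∃ e, G.o e = v ∧ G.t e = w).Connected

/-- The cyclomatic number `1 + r - s` for `r` edges and `s` vertices. -/
def cyc (_ : MetricGraph V E) : ℤ := 1 + (Nat.card E : ℤ) - (Nat.card V : ℤ)

/-! A function on the graph is a family `f : E → ℝ → ℂ`, of which only the restrictions of `f e`
to `[0, L_e]` matter. -/

/-- Continuity on the graph. -/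
def IsContinuous (f : E → ℝ → ℂ) : Prop :=
  (∀ e, ContinuousOn (f e) (G.interval e)) ∧
    ∀ p p', G.vertexOf p = G.vertexOf p' → G.endpointValue f p = G.endpointValue f p'

/-- The value `f (v)`: the value of an arbitrary component of `f` at the vertex `v`. -/
def vertexValue (f : E → ℝ → ℂ) (v : V) : ℂ :=
  G.endpointValue f (Classical.choose (G.exists_endpoint v))

/-- The derivative of the component of `f` on the edge `e` (one-sided at the endpoints). -/
def edgeDeriv (f : E → ℝ → ℂ) (e : E) (x : ℝ) : ℂ := derivWithin (f e) (G.interval e) x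

/-- All components are differentiable, and they and their derivatives are absolutely continuous. -/
def IsAC2 (f : E → ℝ → ℂ) : Prop :=
  ∀ e, DifferentiableOn ℝ (f e) (G.interval e) ∧
    AbsolutelyContinuousOnInterval (f e) 0 (G.length e) ∧
    AbsolutelyContinuousOnInterval (G.edgeDeriv f e) 0 (G.length e)

open Classical in
/-- The sum of the derivatives of `f` at the vertex `v`, in the directions pointing outwards from
the edges. -/
def normalDeriv [Fintype E] (f : E → ℝ → ℂ) (v : V) : ℂ :=
  (∑ e with G.t e = v, G.edgeDeriv f e (G.length e)) - ∑ e with G.o e = v, G.edgeDeriv f e 0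

/-- Membership in `L²` of all edges. -/
def IsL2 (f : E → ℝ → ℂ) : Prop := ∀ e, MemLp (f e) 2 (volume.restrict (G.interval e))

/-- The Schrödinger differential expression `- f'' + q f`. -/
def schrodinger (q : E → ℝ → ℝ) (f : E → ℝ → ℂ) (e : E) (x : ℝ) : ℂ :=
  - derivWithin (G.edgeDeriv f e) (G.interval e) x + (q e x : ℂ) * f e x

/-- Equality of two functions on the graph almost everywhere. -/
def AEEqual (f g : E → ℝ → ℂ) : Prop := ∀ e, f e =ᵐ[volume.restrict (G.interval e)] g e

/-- The Hilbert space `L²(G)`. -/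
abbrev L2 : Type _ := PiLp 2 fun e => Lp ℂ 2 (volume.restrict (G.interval e))

/-- The functions in the domain of the operator `A_α`. -/
def InDomain [Fintype E] (q : E → ℝ → ℝ) (α : V → ℝ) (f : E → ℝ → ℂ) : Prop :=
  G.IsL2 f ∧ G.IsAC2 f ∧ G.IsL2 (G.schrodinger q f) ∧ G.IsContinuous f ∧
    ∀ v, G.normalDeriv f v - (α v : ℂ) * G.vertexValue f v = 0

section Linear

variable {G} {f g : E → ℝ → ℂ}

theorem uniqueDiffOn (e : E) : UniqueDiffOn ℝ (G.interval e) :=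
  uniqueDiffOn_Icc (G.length_pos e)

theorem zero_mem_interval (e : E) : (0 : ℝ) ∈ G.interval e :=
  ⟨le_rfl, (G.length_pos e).le⟩

theorem length_mem_interval (e : E) : G.length e ∈ G.interval e :=
  ⟨(G.length_pos e).le, le_rfl⟩

theorem edgeDeriv_add (hf : G.IsAC2 f) (hg : G.IsAC2 g) (e : E) :
    EqOn (G.edgeDeriv (f + g) e) (G.edgeDeriv f e + G.edgeDeriv g e) (G.interval e) :=
  fun x hx => derivWithin_add ((hf e).1 x hx) ((hg e).1 x hx)

theorem edgeDeriv_smul (c : ℂ) (f : E → ℝ → ℂ) (e : E) :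
    G.edgeDeriv (c • f) e = c • G.edgeDeriv f e := by
  funext x
  exact derivWithin_const_smul_field c (f e)

theorem acOn_congr {u w : ℝ → ℂ} {a b : ℝ} (hab : a ≤ b)
    (hu : AbsolutelyContinuousOnInterval u a b) (h : EqOn w u (Icc a b)) :
    AbsolutelyContinuousOnInterval w a b := by
  rw [absolutelyContinuousOnInterval_iff] at hu ⊢
  intro ε hε
  obtain ⟨δ, hδ, H⟩ := hu ε hε
  refine ⟨δ, hδ, fun I hI hI' => ?_⟩
  have key := H I hI hI'
  have hmem := hI.1
  rw [uIcc_of_le hab] at hmem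
  rw [Finset.sum_congr rfl fun i hi => by rw [h (hmem i hi).1, h (hmem i hi).2]]
  exact key

theorem ae_differentiable_edgeDeriv (hf : G.IsAC2 f) (e : E) :
    ∀ᵐ x ∂volume.restrict (G.interval e),
      DifferentiableWithinAt ℝ (G.edgeDeriv f e) (G.interval e) x := by
  have h := (hf e).2.2.boundedVariationOn.locallyBoundedVariationOn
  rw [uIcc_of_le (G.length_pos e).le] at h
  exact (ae_restrict_iff' measurableSet_Icc).2 h.ae_differentiableWithinAt_of_mem

theorem IsAC2.add (hf : G.IsAC2 f) (hg : G.IsAC2 g) : G.IsAC2 (f + g) := fun e =>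
  ⟨(hf e).1.add (hg e).1, (hf e).2.1.add (hg e).2.1,
    acOn_congr (G.length_pos e).le ((hf e).2.2.add (hg e).2.2) (edgeDeriv_add hf hg e)⟩

theorem IsAC2.smul (c : ℂ) (hf : G.IsAC2 f) : G.IsAC2 (c • f) := fun e => by
  refine ⟨(hf e).1.const_smul c, (hf e).2.1.const_smul c, ?_⟩
  rw [edgeDeriv_smul]
  exact (hf e).2.2.const_smul c

theorem schrodinger_add (q : E → ℝ → ℝ) (hf : G.IsAC2 f) (hg : G.IsAC2 g) :
    G.AEEqual (G.schrodinger q (f + g)) (G.schrodinger q f + G.schrodinger q g) := by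
  intro e
  filter_upwards [ae_differentiable_edgeDeriv hf e, ae_differentiable_edgeDeriv hg e,
    ae_restrict_mem (measurableSet_Icc (a := (0 : ℝ)) (b := G.length e))] with x hx hx' hmem
  simp only [schrodinger, Pi.add_apply]
  rw [derivWithin_congr (edgeDeriv_add hf hg e) (edgeDeriv_add hf hg e hmem),
    derivWithin_add hx hx']
  ring

theorem schrodinger_smul (q : E → ℝ → ℝ) (c : ℂ) (f : E → ℝ → ℂ) :
    G.schrodinger q (c • f) = c • G.schrodinger q f := by
  funext e x
  simp only [schrodinger, edgeDeriv_smul, Pi.smul_apply, smul_eq_mul]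
  have : derivWithin (c • G.edgeDeriv f e) (G.interval e) x
      = c • derivWithin (G.edgeDeriv f e) (G.interval e) x :=
    derivWithin_const_smul_field c (G.edgeDeriv f e)
  rw [this, smul_eq_mul]
  ring

theorem IsContinuous.add (hf : G.IsContinuous f) (hg : G.IsContinuous g) :
    G.IsContinuous (f + g) :=
  ⟨fun e => (hf.1 e).add (hg.1 e), fun p p' h => by
    have h1 := hf.2 p p' h
    have h2 := hg.2 p p' h
    simp only [endpointValue, Pi.add_apply] at h1 h2 ⊢
    rw [h1, h2]⟩

theorem IsContinuous.smul (c : ℂ) (hf : G.IsContinuous f) : G.IsContinuous (c • f) :=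
  ⟨fun e => (hf.1 e).const_smul c, fun p p' h => by
    have h1 := hf.2 p p' h
    simp only [endpointValue, Pi.smul_apply] at h1 ⊢
    rw [h1]⟩

theorem normalDeriv_add [Fintype E] (hf : G.IsAC2 f) (hg : G.IsAC2 g) (v : V) :
    G.normalDeriv (f + g) v = G.normalDeriv f v + G.normalDeriv g v := by
  classical
  simp only [normalDeriv]
  rw [Finset.sum_congr rfl fun e _ => edgeDeriv_add hf hg e (length_mem_interval e),
    Finset.sum_congr rfl fun e _ => edgeDeriv_add hf hg e (zero_mem_interval e)]
  simp only [Pi.add_apply, Finset.sum_add_distrib]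
  ring

theorem normalDeriv_smul [Fintype E] (c : ℂ) (f : E → ℝ → ℂ) (v : V) :
    G.normalDeriv (c • f) v = c * G.normalDeriv f v := by
  classical
  simp only [normalDeriv, edgeDeriv_smul, Pi.smul_apply, smul_eq_mul, ← Finset.mul_sum]
  ring

theorem InDomain.add [Fintype E] {q : E → ℝ → ℝ} {α : V → ℝ} (hf : G.InDomain q α f)
    (hg : G.InDomain q α g) : G.InDomain q α (f + g) := by
  obtain ⟨f1, f2, f3, f4, f5⟩ := hf
  obtain ⟨g1, g2, g3, g4, g5⟩ := hg
  refine ⟨fun e => (f1 e).add (g1 e), f2.add g2,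
    fun e => ((f3 e).add (g3 e)).ae_eq (schrodinger_add q f2 g2 e).symm, f4.add g4, fun v => ?_⟩
  have hv : G.vertexValue (f + g) v = G.vertexValue f v + G.vertexValue g v := rfl
  rw [normalDeriv_add f2 g2, hv]
  linear_combination f5 v + g5 v

theorem InDomain.smul [Fintype E] {q : E → ℝ → ℝ} {α : V → ℝ} (c : ℂ)
    (hf : G.InDomain q α f) : G.InDomain q α (c • f) := by
  obtain ⟨f1, f2, f3, f4, f5⟩ := hf
  refine ⟨fun e => (f1 e).const_smul c, f2.smul c, fun e => ?_, f4.smul c, fun v => ?_⟩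
  · rw [schrodinger_smul]
    exact (f3 e).const_smul c
  · have hv : G.vertexValue (c • f) v = c * G.vertexValue f v := rfl
    rw [normalDeriv_smul, hv]
    linear_combination c * f5 v

theorem inDomain_zero [Fintype E] (q : E → ℝ → ℝ) (α : V → ℝ) :
    G.InDomain q α 0 ∧ G.schrodinger q 0 = 0 := by
  have hd : G.edgeDeriv 0 = 0 := by
    funext e x
    simp [edgeDeriv]
  have hs : G.schrodinger q 0 = 0 := by
    funext e x
    simp [schrodinger, hd]
  have hac : ∀ b : ℝ, AbsolutelyContinuousOnInterval (0 : ℝ → ℂ) 0 b := fun b => by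
    have h : LipschitzOnWith 0 (0 : ℝ → ℂ) (uIcc 0 b) := by
      intro x _ y _
      simp
    exact h.absolutelyContinuousOnInterval
  refine ⟨⟨fun e => MemLp.zero, fun e => ⟨differentiableOn_const 0, hac _, ?_⟩, ?_,
    ⟨fun e => continuousOn_const, fun p p' _ => rfl⟩, fun v => ?_⟩, hs⟩
  · rw [hd]
    exact hac _
  · rw [hs]
    exact fun e => MemLp.zero
  · simp [normalDeriv, hd, vertexValue, endpointValue]

end Linear

/-- The graph of the operator `A_α`: the pairs of the classes of `f` and `- f'' + q f`, for `f` in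
the domain. -/
def operatorGraph [Fintype E] (q : E → ℝ → ℝ) (α : V → ℝ) : Submodule ℂ (G.L2 × G.L2) where
  carrier := {u | ∃ f, G.InDomain q α f ∧ G.AEEqual (fun e => u.1 e) f ∧
    G.AEEqual (fun e => u.2 e) (G.schrodinger q f)}
  add_mem' := by
    rintro a b ⟨f, hf, hf1, hf2⟩ ⟨g, hg, hg1, hg2⟩
    refine ⟨f + g, hf.add hg, fun e => ?_, fun e => ?_⟩
    · exact (Lp.coeFn_add (a.1 e) (b.1 e)).trans ((hf1 e).add (hg1 e))
    · exact ((Lp.coeFn_add (a.2 e) (b.2 e)).trans ((hf2 e).add (hg2 e))).trans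
        (schrodinger_add q hf.2.1 hg.2.1 e).symm
  zero_mem' := by
    refine ⟨0, (inDomain_zero q α).1, fun e => Lp.coeFn_zero _ _ _, fun e => ?_⟩
    rw [(inDomain_zero q α).2]
    exact Lp.coeFn_zero _ _ _
  smul_mem' := by
    rintro c a ⟨f, hf, hf1, hf2⟩
    refine ⟨c • f, hf.smul c, fun e => ?_, fun e => ?_⟩
    · exact (Lp.coeFn_smul c (a.1 e)).trans ((hf1 e).const_smul c)
    · rw [schrodinger_smul]
      exact (Lp.coeFn_smul c (a.2 e)).trans ((hf2 e).const_smul c)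

/-- The Schrödinger operator `A_α` in `L²(G)`. -/
def operator [Fintype E] (q : E → ℝ → ℝ) (α : V → ℝ) : G.L2 →ₗ.[ℂ] G.L2 :=
  (G.operatorGraph q α).toLinearPMap

/-- The operator is well defined: its graph is `operatorGraph`. -/
theorem operator_graph [Fintype E] (q : E → ℝ → ℝ) (α : V → ℝ) :
    (G.operator q α).graph = G.operatorGraph q α := by
  apply Submodule.toLinearPMap_graph_eq
  rintro ⟨u, w⟩ ⟨f, hf, h1, h2⟩ hu
  simp only at hu h1 h2
  subst hu
  have hf0 : ∀ e, EqOn (f e) 0 (G.interval e) := fun e =>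
    Measure.eqOn_Icc_of_ae_eq volume (G.length_pos e).ne
      ((h1 e).symm.trans (Lp.coeFn_zero _ _ _)) (hf.2.2.2.1.1 e) continuousOn_const
  have hd : ∀ e, EqOn (G.edgeDeriv f e) 0 (G.interval e) := fun e x hx => by
    rw [edgeDeriv, derivWithin_congr (hf0 e) (hf0 e hx)]
    simp
  ext1 e
  apply Lp.ext
  refine (h2 e).trans (EventuallyEq.trans ?_ (Lp.coeFn_zero _ _ _).symm)
  filter_upwards [ae_restrict_mem (measurableSet_Icc (a := (0 : ℝ)) (b := G.length e))]
    with x hmem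
  rw [schrodinger, derivWithin_congr (hd e) (hd e hmem), hf0 e hmem]
  simp

end

end MetricGraph

/-- The resolvent set of an operator `A` in a Hilbert space: the `μ` for which `A - μ` is a
bijection from its domain onto the space with an (everywhere defined) bounded inverse. -/
def LinearPMap.resolventSet {H : Type*} [NormedAddCommGroup H] [InnerProductSpace ℂ H]
    (A : H →ₗ.[ℂ] H) : Set ℂ :=
  {μ | ∃ R : H →L[ℂ] H, (∀ y, ∃ x : A.domain, (x : H) = R y ∧ A x - μ • (x : H) = y) ∧
    ∀ x : A.domain, R (A x - μ • (x : H)) = x}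

/-- The kernel of `A - μ`, as a subspace of the domain of `A`. -/
def LinearPMap.eigenspace {H : Type*} [NormedAddCommGroup H] [InnerProductSpace ℂ H]
    (A : H →ₗ.[ℂ] H) (μ : ℂ) : Submodule ℂ A.domain :=
  LinearMap.ker (A.toFun - μ • A.domain.subtype)

namespace MetricGraph

noncomputable section

variable {V E : Type*} (G : MetricGraph V E)

/-- `f` solves `- f'' + q f = μ f` on the graph, is continuous on the graph, and satisfies the
inhomogeneous vertex conditions with right-hand side `h`. -/
def IsSolution [Fintype E] (q : E → ℝ → ℝ) (α : V → ℝ) (μ : ℂ) (h : V → ℂ)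
    (f : E → ℝ → ℂ) : Prop :=
  G.IsL2 f ∧ G.IsAC2 f ∧ G.AEEqual (G.schrodinger q f) (μ • f) ∧ G.IsContinuous f ∧
    ∀ v, G.normalDeriv f v - (α v : ℂ) * G.vertexValue f v = h v

open Classical in
/-- The Titchmarsh-Weyl matrix for the vertex set `B`. It is meaningful for `μ` in the resolvent set
of `A_α`, where the solution exists and is unique on the graph. -/
def titchmarshWeyl [Fintype E] (q : E → ℝ → ℝ) (α : V → ℝ) (B : Finset V) (μ : ℂ) :
    Matrix B B ℂ :=
  Matrix.of fun k l =>
    G.vertexValue (Classical.epsilon (G.IsSolution q α μ (Pi.single (l : V) 1))) k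

end

end MetricGraph

/-- `R` is defined and analytic (on its domain `Ω`) in a punctured neighbourhood of `z`. -/
def AnalyticAround {n : Type*} (Ω : Set ℂ) (R : ℂ → Matrix n n ℂ) (z : ℂ) : Prop :=
  ∃ U : Set ℂ, IsOpen U ∧ z ∈ U ∧ U \ {z} ⊆ Ω ∧
    ∀ i j, DifferentiableOn ℂ (fun w => R w i j) (U \ {z})

/-- `z` is a pole of order `k` of the analytic matrix function `R` on `Ω`. -/
def IsPoleOfOrder {n : Type*} (Ω : Set ℂ) (R : ℂ → Matrix n n ℂ) (z : ℂ) (k : ℕ) : Prop :=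
  AnalyticAround Ω R z ∧
    (∃ T : Matrix n n ℂ, T ≠ 0 ∧ Tendsto (fun w => (w - z) ^ k • R w) (𝓝[≠] z) (𝓝 T)) ∧
    Tendsto (fun w => (w - z) ^ (k + 1) • R w) (𝓝[≠] z) (𝓝 0)

/-- `z` is a pole (of positive order) of `R`. -/
def IsPole {n : Type*} (Ω : Set ℂ) (R : ℂ → Matrix n n ℂ) (z : ℂ) : Prop :=
  ∃ k, 1 ≤ k ∧ IsPoleOfOrder Ω R z k

/-- `T` is the residue of `R` at `z`: `R` is analytic in a punctured neighbourhood of `z`, and `T` is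
the integral of `R / (2 π i)` over all small circles around `z`. -/
def HasResidue {n : Type*} (Ω : Set ℂ) (R : ℂ → Matrix n n ℂ) (z : ℂ) (T : Matrix n n ℂ) : Prop :=
  AnalyticAround Ω R z ∧ ∀ᶠ r : ℝ in 𝓝[>] 0, ∀ i j,
    T i j = (2 * (Real.pi : ℂ) * Complex.I)⁻¹ * ∮ w in C(z, r), R w i j

/-!
The eigenvalue multiplicity is compared with the rank of the residue by computing the Laurent
expansion of the Titchmarsh-Weyl matrix at `lam` and identifying the residue as a Gram matrix.

On each edge the Cauchy problem for `- y'' + (q - lam) y = g` is uniquely solvable by Volterra's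
integral equation (`bijective_one_sub_volterra`), also for integrable `q`. Hence a boundary value
problem on the graph is a finite-dimensional linear system for the Cauchy data on the edges and the
values at the vertices, with as many equations as unknowns; its deviation from being solved is
`MetricGraph.defect`. Counting dimensions and using the symmetry of `A_α`, every inhomogeneity in
the vertex conditions is attained with a right-hand side from `N = ker (A_α - lam)`
(`MetricGraph.exists_defect_eq`), and `A_α - lam` maps onto the orthogonal complement of `N`
(`MetricGraph.exists_operator_sub_eq`). Being symmetric and everywhere defined, the inverse on this
complement is bounded, by the theorem of Hellinger and Toeplitz
(`LinearPMap.exists_isPseudoInverse`). So the resolvent at `lam + z` is `K (1 - z K)⁻¹ - z⁻¹ P` for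
small `z ≠ 0`, with the pseudo-inverse `K` and the projection `P` onto `N`; no general theory of
self-adjoint operators with compact resolvent enters.

Let `n_v ∈ N` be the right-hand side for a unit inhomogeneity at the vertex `v`. Green's formula
shows that `M` has at most a simple pole at `lam`, with residue the matrix `- ⟪n_k, n_l⟫`
(`MetricGraph.exists_hasSimplePart_titchmarshWeyl`), and that `u (v) = - ⟪n_v, u⟫` for `u ∈ N`
(`MetricGraph.green_single`). The rank of the residue is therefore the codimension in `N` of the
eigenfunctions that vanish on the boundary (`rank_neg_gram_add_finrank`), and the theorem amounts to
the bound `2 cyc G - 1` for the dimension of this subspace. That bound is combinatorial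
(`MetricGraph.finrank_le_of_vanish_on_boundary`): following a breadth-first tree from a vertex where
all these eigenfunctions vanish, such an eigenfunction is determined by sufficiently few of its
derivatives at the endpoints of edges.
-/

/-! ### Eigenfunctions that vanish on the boundary: the combinatorial bound -/

namespace MetricGraph

variable {V E : Type*} (G : MetricGraph V E)

/-- From every vertex other than `r`, some edge leads to a vertex that is closer to `r`. -/
theorem exists_endpoint_dist_lt (hconn : G.IsConnected) {r v : V} (h : v ≠ r) :
    ∃ p : E × Bool, G.vertexOf p = v ∧
      (SimpleGraph.fromRel fun v w => ∃ e, G.o e = v ∧ G.t e = w).dist r (G.vertexOf (p.1, !p.2)) <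
        (SimpleGraph.fromRel fun v w => ∃ e, G.o e = v ∧ G.t e = w).dist r v := by
  set Γ := SimpleGraph.fromRel fun v w => ∃ e, G.o e = v ∧ G.t e = w with hΓ
  have hc : Γ.Connected := hconn
  obtain ⟨w, hw⟩ := hc.exists_walk_length_eq_dist v r
  cases w with
  | nil => exact absurd rfl h
  | @cons _ u _ hadj w' =>
    have h1 : Γ.dist r u < Γ.dist r v := by
      rw [SimpleGraph.dist_comm (u := r), SimpleGraph.dist_comm (u := r), ← hw,
        SimpleGraph.Walk.length_cons]
      exact Nat.lt_succ_of_le (SimpleGraph.dist_le w')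
    rw [hΓ, SimpleGraph.fromRel_adj] at hadj
    obtain ⟨-, ⟨e, h2, h3⟩ | ⟨e, h2, h3⟩⟩ := hadj
    · exact ⟨(e, false), h2, by simpa [vertexOf, h3] using h1⟩
    · exact ⟨(e, true), h3, by simpa [vertexOf, h2] using h1⟩

theorem mem_boundary_of_unique_endpoint [Fintype V] {p₀ : E × Bool}
    (h : ∀ p, G.vertexOf p = G.vertexOf p₀ → p = p₀) : G.vertexOf p₀ ∈ G.boundary := by
  classical
  refine Finset.mem_filter.2 ⟨Finset.mem_univ _, Nat.card_eq_one_iff_unique.2 ?_⟩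
  exact ⟨⟨fun a b => Subtype.ext ((h a a.2).trans (h b b.2).symm)⟩, ⟨⟨p₀, rfl⟩⟩⟩

theorem exists_unique_endpoint_of_mem_boundary [Fintype V] {v : V} (h : v ∈ G.boundary) :
    ∃ p₀, G.vertexOf p₀ = v ∧ ∀ p, G.vertexOf p = v → p = p₀ := by
  classical
  obtain ⟨h1, ⟨p₀⟩⟩ := Nat.card_eq_one_iff_unique.1 (Finset.mem_filter.1 h).2
  exact ⟨p₀.1, p₀.2, fun p hp => congrArg Subtype.val (h1.elim ⟨p, hp⟩ p₀)⟩

open Classical in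
/-- A purely algebraic form of the bound `2 cyc G - 1` for the space of eigenfunctions that vanish
on the boundary. The elements of `W` have a value `val v` at each vertex and an outward derivative
`der p` at each endpoint of an edge; on an edge, zero Cauchy data at one endpoint propagate to the
other one.

Let `S` be the set of edges on which some element of `W` does not vanish, and let `r₀` be a vertex
that touches both `S` and its complement. An element of `W` is determined by its outward derivatives
at those endpoints of the edges in `S` that remain when one deletes, at each vertex `v`, the
endpoint `π v` of an edge leading towards `r₀` (for `v ≠ r₀`) and a further endpoint `χ v`, the
derivative at which follows from the Kirchhoff condition. Edges leading towards `r₀` from distinct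
vertices are distinct, and every vertex that does not touch `S` is left by such an edge outside `S`.
Hence, if `b` is the number of the `v ≠ r₀` with `π v` outside `S`, then at most
`2 |S| - (|V| - 1 - b) - (|V| - b) ≤ 2 |E| - 2 |V| + 1` endpoints remain. -/
theorem finrank_le_of_vanish_on_boundary [Fintype V] [Fintype E] (hconn : G.IsConnected)
    (hcyc : 1 ≤ G.cyc) (hB : G.boundary.Nonempty)
    {W : Type*} [AddCommGroup W] [Module ℂ W] [FiniteDimensional ℂ W]
    (val : V → W →ₗ[ℂ] ℂ) (der : E × Bool → W →ₗ[ℂ] ℂ)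
    (hedge : ∀ p x, val (G.vertexOf p) x = 0 → der p x = 0 →
      val (G.vertexOf (p.1, !p.2)) x = 0 ∧ der (p.1, !p.2) x = 0)
    (hK : ∀ v x, val v x = 0 → ∑ p with G.vertexOf p = v, der p x = 0)
    (hbd : ∀ v ∈ G.boundary, ∀ x, val v x = 0)
    (hsep : ∀ x, (∀ v, val v x = 0) → (∀ p, der p x = 0) → x = 0) :
    (Module.finrank ℂ W : ℤ) ≤ 2 * G.cyc - 1 := by
  set D := (SimpleGraph.fromRel fun v w => ∃ e, G.o e = v ∧ G.t e = w).dist with hD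
  set S : Finset E := Finset.univ.filter fun e =>
    ∃ b x, val (G.vertexOf (e, b)) x ≠ 0 ∨ der (e, b) x ≠ 0 with hS
  have hval : ∀ p : E × Bool, p.1 ∉ S → ∀ x, val (G.vertexOf p) x = 0 := by
    rintro ⟨e, b⟩ hp x
    by_contra hne
    exact hp (Finset.mem_filter.2 ⟨Finset.mem_univ _, b, x, Or.inl hne⟩)
  have hder : ∀ p : E × Bool, p.1 ∉ S → ∀ x, der p x = 0 := by
    rintro ⟨e, b⟩ hp x
    by_contra hne
    exact hp (Finset.mem_filter.2 ⟨Finset.mem_univ _, b, x, Or.inr hne⟩)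
  -- A vertex that meets `S` is never the end of exactly one edge of `S`.
  have hcore : ∀ p₀ : E × Bool, p₀.1 ∈ S →
      ∃ p, p ≠ p₀ ∧ G.vertexOf p = G.vertexOf p₀ ∧ p.1 ∈ S := by
    intro p₀ hp₀
    by_contra! hcon
    have hv : ∀ x, val (G.vertexOf p₀) x = 0 := by
      intro x
      by_cases huni : ∀ p, G.vertexOf p = G.vertexOf p₀ → p = p₀
      · exact hbd _ (G.mem_boundary_of_unique_endpoint huni) x
      · push Not at huni
        obtain ⟨p, hp, hne⟩ := huni
        rw [← hp]
        exact hval p (hcon p hne hp) x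
    have hd : ∀ x, der p₀ x = 0 := by
      intro x
      rw [← hK _ x (hv x), Finset.sum_eq_single p₀]
      · intro p hp hne
        exact hder p (hcon p hne (by simpa using hp)) x
      · intro h
        exact absurd (by simp) h
    obtain ⟨e, b⟩ := p₀
    obtain ⟨b', x, hx⟩ := (Finset.mem_filter.1 hp₀).2
    have h2 := hedge (e, b) x (hv x) (hd x)
    have hbb : b' = b ∨ b' = !b := by cases b <;> cases b' <;> simp
    rcases hbb with rfl | rfl
    · exact hx.elim (fun h => h (hv x)) (fun h => h (hd x))
    · exact hx.elim (fun h => h h2.1) (fun h => h h2.2)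
  rcases S.eq_empty_or_nonempty with hSe | ⟨e₀, he₀⟩
  · have hsub : Subsingleton W := by
      refine subsingleton_of_forall_eq 0 fun x => hsep x (fun v => ?_) fun p => ?_
      · obtain ⟨p, hp⟩ := G.exists_endpoint v
        have hp' : G.vertexOf p = v := hp
        rw [← hp']
        exact hval p (by simp [hSe]) x
      · exact hder p (by simp [hSe]) x
    rw [Module.finrank_zero_of_subsingleton]
    push_cast
    lia
  set VS : Finset V := Finset.univ.filter fun v => ∃ p, G.vertexOf p = v ∧ p.1 ∈ S with hVS
  have hVS_mem : ∀ p : E × Bool, p.1 ∈ S → G.vertexOf p ∈ VS := fun p hp =>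
    Finset.mem_filter.2 ⟨Finset.mem_univ _, p, rfl, hp⟩
  -- The root: a vertex of `S` that is closest to a given boundary vertex.
  obtain ⟨r₀, hr₀, q₀, hq₀, hq₀S⟩ : ∃ r₀ ∈ VS, ∃ q, G.vertexOf q = r₀ ∧ q.1 ∉ S := by
    obtain ⟨b, hb⟩ := hB
    obtain ⟨v, hv, hmin⟩ := Finset.exists_min_image VS (D b) ⟨_, hVS_mem (e₀, true) he₀⟩
    refine ⟨v, hv, ?_⟩
    have hvb : v ≠ b := by
      rintro rfl
      obtain ⟨p₀, -, huni⟩ := G.exists_unique_endpoint_of_mem_boundary hb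
      obtain ⟨p, hp, hpS⟩ := (Finset.mem_filter.1 hv).2
      obtain ⟨p', hne, hp', -⟩ := hcore p hpS
      exact hne ((huni _ (hp'.trans hp)).trans (huni _ hp).symm)
    obtain ⟨p, hp, hlt⟩ := G.exists_endpoint_dist_lt hconn hvb
    exact ⟨p, hp, fun hpS => absurd (hmin _ (hVS_mem (p.1, !p.2) hpS)) (not_le.2 hlt)⟩
  have hπ : ∀ v, ∃ p, G.vertexOf p = v ∧ (v ≠ r₀ → D r₀ (G.vertexOf (p.1, !p.2)) < D r₀ v) := by
    intro v
    by_cases hv : v = r₀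
    · obtain ⟨p, hp⟩ := G.exists_endpoint v
      exact ⟨p, hp, fun h => absurd hv h⟩
    · obtain ⟨p, hp, hlt⟩ := G.exists_endpoint_dist_lt hconn hv
      exact ⟨p, hp, fun _ => hlt⟩
  choose π hπv hπlt using hπ
  have hχ : ∀ v : V, ∃ p, v ∈ VS → G.vertexOf p = v ∧ p.1 ∈ S ∧ p ≠ π v := by
    intro v
    by_cases hv : v ∈ VS
    · obtain ⟨p, hp, hpS⟩ := (Finset.mem_filter.1 hv).2
      by_cases hpπ : p = π v
      · obtain ⟨p', hne, hp', hp'S⟩ := hcore p hpS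
        exact ⟨p', fun _ => ⟨hp'.trans hp, hp'S, fun h => hne (h.trans hpπ.symm)⟩⟩
      · exact ⟨p, fun _ => ⟨hp, hpS, hpπ⟩⟩
    · exact ⟨π v, fun h => absurd h hv⟩
  choose χ hχ using hχ
  set PS : Finset (E × Bool) := S ×ˢ Finset.univ with hPS
  set A : Finset V := Finset.univ.filter fun v => v ≠ r₀ ∧ (π v).1 ∈ S with hA
  set B : Finset V := Finset.univ.filter fun v => v ≠ r₀ ∧ (π v).1 ∉ S with hBdef
  set F : Finset (E × Bool) := PS \ (A.image π ∪ VS.image χ) with hF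
  have hπinj : Function.Injective π := fun v w h => by rw [← hπv v, ← hπv w, h]
  have hχinj : InjOn χ VS := fun v hv w hw h => by
    rw [← (hχ v hv).1, ← (hχ w hw).1, h]
  have hFcard : F.card + A.card + VS.card = 2 * S.card := by
    have hdisj : Disjoint (A.image π) (VS.image χ) := by
      rw [Finset.disjoint_left]
      intro p hp hp'
      obtain ⟨v, -, rfl⟩ := Finset.mem_image.1 hp
      obtain ⟨w, hw, hwv⟩ := Finset.mem_image.1 hp'
      obtain ⟨h1, -, h3⟩ := hχ w hw
      have : w = v := by rw [← h1, hwv, hπv]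
      exact h3 (by rw [hwv, this])
    have hsub : A.image π ∪ VS.image χ ⊆ PS := by
      intro p hp
      rcases Finset.mem_union.1 hp with hp | hp
      · obtain ⟨v, hv, rfl⟩ := Finset.mem_image.1 hp
        simpa [hPS] using (Finset.mem_filter.1 hv).2.2
      · obtain ⟨v, hv, rfl⟩ := Finset.mem_image.1 hp
        simpa [hPS] using (hχ v hv).2.1
    have h1 := Finset.card_sdiff_add_card_eq_card hsub
    rw [Finset.card_union_of_disjoint hdisj, Finset.card_image_of_injective _ hπinj,
      Finset.card_image_of_injOn hχinj, ← hF] at h1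
    have h2 : PS.card = S.card * 2 := by simp [hPS]
    lia
  have hAB : A.card + B.card + 1 = Fintype.card V := by
    have h1 : A.card + B.card = (Finset.univ.erase r₀).card := by
      rw [← Finset.card_union_of_disjoint]
      · congr 1
        ext v
        simp only [hA, hBdef, Finset.mem_union, Finset.mem_filter, Finset.mem_univ, true_and,
          Finset.mem_erase, and_true]
        tauto
      · rw [Finset.disjoint_left]
        intro v hv hv'
        exact (Finset.mem_filter.1 hv').2.2 (Finset.mem_filter.1 hv).2.2
    rw [h1, Finset.card_erase_add_one (Finset.mem_univ _), Finset.card_univ]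
  have hVSB : Fintype.card V ≤ VS.card + B.card := by
    rw [← Finset.card_univ, ← Finset.card_sdiff_add_card_eq_card (Finset.subset_univ VS),
      add_comm]
    refine Nat.add_le_add_left (Finset.card_le_card fun v hv => ?_) _
    have hv' := (Finset.mem_sdiff.1 hv).2
    refine Finset.mem_filter.2 ⟨Finset.mem_univ _, fun h => hv' (h ▸ hr₀), fun h => hv' ?_⟩
    simpa [hπv] using hVS_mem (π v) h
  -- An edge cannot lead towards the root in both directions.
  have hBS : B.card + S.card ≤ Fintype.card E := by
    have h1 : B.card ≤ (Finset.univ \ S).card := by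
      refine Finset.card_le_card_of_injOn (fun v => (π v).1) (fun v hv => ?_) ?_
      · simpa using (Finset.mem_filter.1 hv).2.2
      · intro v hv w hw h
        have hv' := (Finset.mem_filter.1 hv).2.1
        have hw' := (Finset.mem_filter.1 hw).2.1
        dsimp only at h
        have hbb : (π v).2 = (π w).2 ∨ (π v).2 = !(π w).2 := by
          cases (π v).2 <;> cases (π w).2 <;> simp
        rcases hbb with h2 | h2
        · exact hπinj (Prod.ext h h2)
        · have h3 := hπlt v hv'
          have h4 := hπlt w hw'
          rw [h, h2, Bool.not_not, Prod.mk.eta, hπv w] at h3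
          rw [← h, ← h2, Prod.mk.eta, hπv v] at h4
          exact absurd h3 (not_lt.2 h4.le)
    have h2 := Finset.card_sdiff_add_card_eq_card (Finset.subset_univ S)
    rw [Finset.card_univ] at h2
    lia
  let Φ : W →ₗ[ℂ] (F → ℂ) := LinearMap.pi fun p => der p
  have hΦ : Function.Injective Φ := by
    rw [injective_iff_map_eq_zero]
    intro x hx
    have hxF : ∀ p ∈ F, der p x = 0 := fun p hp => congrFun hx ⟨p, hp⟩
    have key : ∀ n v, D r₀ v = n →
        val v x = 0 ∧ ∀ p, G.vertexOf p = v → der p x = 0 := by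
      intro n
      induction n using Nat.strong_induction_on with
      | _ n ih =>
        intro v hn
        have hvπ : val v x = 0 ∧ (v ≠ r₀ → der (π v) x = 0) := by
          by_cases hv : v = r₀
          · refine ⟨?_, fun h => absurd hv h⟩
            rw [hv, ← hq₀]
            exact hval q₀ hq₀S x
          · obtain ⟨h1, h2⟩ := ih _ (hn ▸ hπlt v hv) _ rfl
            have h3 := hedge _ x h1 (h2 _ rfl)
            simp only [Bool.not_not, Prod.mk.eta, hπv] at h3
            exact ⟨h3.1, fun _ => h3.2⟩
        have hother : ∀ p, G.vertexOf p = v → p ≠ χ v → der p x = 0 := by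
          intro p hp hpχ
          by_cases hpS : p.1 ∈ S
          · by_cases hpF : p ∈ F
            · exact hxF p hpF
            · have hpPS : p ∈ PS := by simpa [hPS] using hpS
              have : p ∈ A.image π ∪ VS.image χ := by
                by_contra h
                exact hpF (Finset.mem_sdiff.2 ⟨hpPS, h⟩)
              rcases Finset.mem_union.1 this with h | h
              · obtain ⟨w, hw, rfl⟩ := Finset.mem_image.1 h
                obtain rfl : w = v := by rw [← hp, hπv]
                exact hvπ.2 (Finset.mem_filter.1 hw).2.1
              · obtain ⟨w, hw, rfl⟩ := Finset.mem_image.1 h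
                obtain rfl : w = v := by rw [← hp, (hχ w hw).1]
                exact absurd rfl hpχ
          · exact hder p hpS x
        refine ⟨hvπ.1, fun p hp => ?_⟩
        by_cases hpχ : p = χ v
        · rw [← hK v x hvπ.1, Finset.sum_eq_single p]
          · intro p' hp' hne
            exact hother p' (by simpa using hp') fun h => hne (h.trans hpχ.symm)
          · intro h
            exact absurd (by simpa using hp) h
        · exact hother p hp hpχ
    exact hsep x (fun v => (key _ v rfl).1) fun p => (key _ _ rfl).2 p rfl
  have hfin := LinearMap.finrank_le_finrank_of_injective hΦ
  rw [Module.finrank_fintype_fun_eq_card, Fintype.card_coe] at hfin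
  simp only [cyc, Nat.card_eq_fintype_card]
  lia

end MetricGraph

/-! ### The resolvent of a symmetric operator near an eigenvalue -/

namespace LinearPMap

variable {H : Type*} [NormedAddCommGroup H] [InnerProductSpace ℂ H]

/-- The kernel of `A - μ`, as a subspace of the whole space. -/
noncomputable def eigenvectors (A : H →ₗ.[ℂ] H) (μ : ℂ) : Submodule ℂ H :=
  (A.eigenspace μ).map A.domain.subtype

theorem mem_eigenvectors {A : H →ₗ.[ℂ] H} {μ : ℂ} {u : H} :
    u ∈ A.eigenvectors μ ↔ ∃ x : A.domain, A x = μ • (x : H) ∧ (x : H) = u := by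
  simp only [eigenvectors, Submodule.mem_map, eigenspace, LinearMap.mem_ker, LinearMap.sub_apply,
    LinearMap.smul_apply, Submodule.subtype_apply, sub_eq_zero]
  rfl

theorem finrank_eigenvectors (A : H →ₗ.[ℂ] H) (μ : ℂ) :
    Module.finrank ℂ (A.eigenvectors μ) = Module.finrank ℂ (A.eigenspace μ) :=
  (LinearEquiv.finrank_eq (Submodule.equivMapOfInjective _ A.domain.subtype_injective _)).symm

/-- `K` inverts `A - lam` on the orthogonal complement of the kernel of `A - lam` and vanishes on
this kernel. -/
structure IsPseudoInverse (A : H →ₗ.[ℂ] H) (lam : ℂ) [(A.eigenvectors lam).HasOrthogonalProjection]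
    (K : H →L[ℂ] H) : Prop where
  right_inv : ∀ g, ∃ x : A.domain, (x : H) = K g ∧
    A x - lam • (x : H) = g - (A.eigenvectors lam).starProjection g
  left_inv : ∀ x : A.domain, K (A x - lam • (x : H)) = x - (A.eigenvectors lam).starProjection x
  map_proj : ∀ g, K ((A.eigenvectors lam).starProjection g) = 0
  proj_map : ∀ g, (A.eigenvectors lam).starProjection (K g) = 0

section

variable {A : H →ₗ.[ℂ] H} {lam : ℝ}

theorem sub_mem_orthogonal (hsym : ∀ x y : A.domain, inner ℂ (A x) (y : H) = inner ℂ (x : H) (A y))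
    (x : A.domain) : A x - (lam : ℂ) • (x : H) ∈ (A.eigenvectors lam)ᗮ := by
  rw [Submodule.mem_orthogonal]
  intro u hu
  obtain ⟨y, hy, rfl⟩ := mem_eigenvectors.1 hu
  rw [inner_sub_right, ← hsym, hy, inner_smul_left, inner_smul_right]
  simp

/-- The pseudo-inverse of a symmetric operator is symmetric and everywhere defined, hence bounded by
the theorem of Hellinger and Toeplitz. -/
theorem exists_isPseudoInverse [CompleteSpace H]
    [(A.eigenvectors (lam : ℂ)).HasOrthogonalProjection]
    (hsym : ∀ x y : A.domain, inner ℂ (A x) (y : H) = inner ℂ (x : H) (A y))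
    (hrange : ∀ g ∈ (A.eigenvectors (lam : ℂ))ᗮ, ∃ x : A.domain, A x - (lam : ℂ) • (x : H) = g) :
    ∃ K : H →L[ℂ] H, A.IsPseudoInverse lam K := by
  set N := A.eigenvectors (lam : ℂ) with hN
  set P := N.starProjection with hP
  have hPort : ∀ g, g - P g ∈ Nᗮ := fun g => N.sub_starProjection_mem_orthogonal g
  have hex : ∀ g, ∃ x : A.domain, A x - (lam : ℂ) • (x : H) = g - P g ∧ (x : H) ∈ Nᗮ := by
    intro g
    obtain ⟨x, hx⟩ := hrange _ (hPort g)
    obtain ⟨y, hy, hyx⟩ := mem_eigenvectors.1 (N.starProjection_apply_mem (x : H))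
    refine ⟨x - y, ?_, ?_⟩
    · rw [map_sub, AddSubgroupClass.coe_sub, smul_sub, hy, ← hx]
      abel
    · rw [AddSubgroupClass.coe_sub, hyx]
      exact hPort _
  have huniq : ∀ x y : A.domain, A x - (lam : ℂ) • (x : H) = A y - (lam : ℂ) • (y : H) →
      (x : H) ∈ Nᗮ → (y : H) ∈ Nᗮ → (x : H) = y := by
    intro x y h hx hy
    have h1 : (x : H) - y ∈ N := by
      refine mem_eigenvectors.2 ⟨x - y, ?_, rfl⟩
      rw [map_sub, AddSubgroupClass.coe_sub, smul_sub, ← sub_eq_zero, sub_sub_sub_comm, h, sub_self]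
    have h2 : (x : H) - y ∈ Nᗮ := Nᗮ.sub_mem hx hy
    exact sub_eq_zero.1 (N.disjoint_def.1 N.orthogonal_disjoint _ h1 h2)
  choose k hk hkN using hex
  let K₀ : H →ₗ[ℂ] H :=
    { toFun := fun g => k g
      map_add' := fun g g' => by
        refine huniq (k (g + g')) (k g + k g') ?_ (hkN _) (Nᗮ.add_mem (hkN g) (hkN g'))
        rw [hk, map_add, _root_.map_add P, AddMemClass.coe_add, smul_add, add_sub_add_comm,
          add_sub_add_comm, hk, hk]
      map_smul' := fun c g => by
        refine huniq (k (c • g)) (c • k g) ?_ (hkN _) (Nᗮ.smul_mem c (hkN g))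
        rw [hk, map_smul, _root_.map_smul P, SetLike.val_smul, smul_comm, ← smul_sub, ← smul_sub,
          hk g] }
  have hK₀ : ∀ g, K₀ g = k g := fun _ => rfl
  have hKsym : K₀.IsSymmetric := by
    intro g g'
    have h1 : inner ℂ (K₀ g) g' = inner ℂ (K₀ g) (g' - P g') := by
      rw [inner_sub_right, hP, hK₀, Submodule.inner_left_of_mem_orthogonal
        (N.starProjection_apply_mem g') (hkN g), sub_zero]
    have h2 : inner ℂ g (K₀ g') = inner ℂ (g - P g) (K₀ g') := by
      rw [inner_sub_left, hP, hK₀, Submodule.inner_right_of_mem_orthogonal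
        (N.starProjection_apply_mem g) (hkN g'), sub_zero]
    rw [h1, h2, ← hk g, ← hk g', hK₀, hK₀, inner_sub_right, inner_sub_left, hsym, inner_smul_left,
      inner_smul_right, Complex.conj_ofReal]
  let K : H →L[ℂ] H := ⟨K₀, hKsym.continuous⟩
  have hKapp : ∀ g, K g = k g := fun _ => rfl
  refine ⟨K, ⟨fun g => ⟨k g, rfl, hk g⟩, fun x => ?_, fun g => ?_, fun g => ?_⟩⟩
  · obtain ⟨y, hy, hyx⟩ := mem_eigenvectors.1 (N.starProjection_apply_mem (x : H))
    rw [hKapp]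
    refine (huniq _ (x - y) ?_ (hkN _) ?_).trans ?_
    · rw [hk, hP, N.starProjection_apply_eq_zero_iff.2 (sub_mem_orthogonal hsym x), map_sub,
        AddSubgroupClass.coe_sub, smul_sub, hy]
      abel
    · rw [AddSubgroupClass.coe_sub, hyx]
      exact hPort _
    · rw [AddSubgroupClass.coe_sub, hyx]
  · rw [hKapp]
    refine huniq _ 0 ?_ (hkN _) (Nᗮ.zero_mem)
    rw [hk, hP, N.starProjection_eq_self_iff.2 (N.starProjection_apply_mem g), sub_self]
    simp
  · exact N.starProjection_apply_eq_zero_iff.2 (hkN g)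

end

section

variable {A : H →ₗ.[ℂ] H} {lam : ℂ} [(A.eigenvectors lam).HasOrthogonalProjection]
  {K : H →L[ℂ] H}

/-- The resolvent of `A` at `lam + z`, in terms of the pseudo-inverse at `lam`. -/
noncomputable def localResolvent (A : H →ₗ.[ℂ] H) (lam : ℂ)
    [(A.eigenvectors lam).HasOrthogonalProjection] (K : H →L[ℂ] H) (z : ℂ) : H →L[ℂ] H :=
  K * Ring.inverse (1 - z • K) - z⁻¹ • (A.eigenvectors lam).starProjection

theorem localResolvent_spec (hK : A.IsPseudoInverse lam K) {z : ℂ} (hz : z ≠ 0)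
    (hu : IsUnit (1 - z • K)) (y : H) :
    ∃ x : A.domain, (x : H) = A.localResolvent lam K z y ∧ A x - (lam + z) • (x : H) = y := by
  set P := (A.eigenvectors lam).starProjection with hP
  set w := Ring.inverse (1 - z • K) y with hw
  have hwy : w - z • K w = y := by
    have := congrArg (fun T : H →L[ℂ] H => T y) (Ring.mul_inverse_cancel _ hu)
    simpa using this
  have hPw : P w = P y := by
    rw [← hwy, _root_.map_sub P, _root_.map_smul P, hP, hK.proj_map, smul_zero, sub_zero]
  obtain ⟨x, hx, hx'⟩ := hK.right_inv w
  obtain ⟨n, hn, hn'⟩ := mem_eigenvectors.1 ((A.eigenvectors lam).starProjection_apply_mem y)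
  refine ⟨x - z⁻¹ • n, ?_, ?_⟩
  · rw [AddSubgroupClass.coe_sub, SetLike.val_smul, hx, hn']
    rfl
  · rw [map_sub, map_smul, AddSubgroupClass.coe_sub, SetLike.val_smul, hn]
    have h1 : A x = w - P w + lam • (x : H) := by rw [← hx']; abel
    rw [h1, hPw, ← hP] at *
    rw [hx, smul_sub, add_smul, add_smul, smul_smul z, mul_inv_cancel₀ hz, one_smul, hn',
      smul_comm lam z⁻¹, ← hwy]
    abel

theorem add_mem_resolventSet (hK : A.IsPseudoInverse lam K)
    (hort : ∀ x : A.domain, (A.eigenvectors lam).starProjection (A x - lam • (x : H)) = 0)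
    {z : ℂ} (hz : z ≠ 0)
    (hu : IsUnit (1 - z • K)) : lam + z ∈ A.resolventSet := by
  refine ⟨A.localResolvent lam K z, localResolvent_spec hK hz hu, fun x => ?_⟩
  set P := (A.eigenvectors lam).starProjection with hP
  have h1 : A x - (lam + z) • (x : H) = (1 - z • K) (A x - lam • (x : H) - z • P x) := by
    simp only [_root_.sub_apply, one_apply_eq_self,
      _root_.smul_apply]
    rw [_root_.map_sub, _root_.map_smul, hK.map_proj, hK.left_inv, add_smul, ← hP]
    simp only [smul_sub]
    simp only [smul_zero, sub_zero]
    abel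
  have h2 : P (A x - (lam + z) • (x : H)) = -(z • P x) := by
    rw [add_smul, ← sub_sub, _root_.map_sub P, hort, _root_.map_smul P, zero_sub]
  have h3 : Ring.inverse (1 - z • K) ((1 - z • K) (A x - lam • (x : H) - z • P x)) =
      A x - lam • (x : H) - z • P x :=
    congrArg (fun T : H →L[ℂ] H => T (A x - lam • (x : H) - z • P x))
      (Ring.inverse_mul_cancel _ hu)
  rw [localResolvent, _root_.sub_apply, _root_.smul_apply, ← hP, h2]
  rw [h1, mul_apply_eq_comp, h3, _root_.map_sub, _root_.map_smul, hK.map_proj, hK.left_inv,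
    smul_neg, smul_smul, inv_mul_cancel₀ hz]
  simp [hP]

end

end LinearPMap

/-! ### Absolutely continuous functions -/

section AbsolutelyContinuous

theorem AbsolutelyContinuousOnInterval.of_dist_le {X Y : Type*} [PseudoMetricSpace X]
    [PseudoMetricSpace Y] {f : ℝ → X} {g : ℝ → Y} {a b : ℝ}
    (hg : AbsolutelyContinuousOnInterval g a b)
    (h : ∀ x ∈ uIcc a b, ∀ y ∈ uIcc a b, dist (f x) (f y) ≤ dist (g x) (g y)) :
    AbsolutelyContinuousOnInterval f a b := by
  rw [absolutelyContinuousOnInterval_iff] at hg ⊢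
  intro ε hε
  obtain ⟨δ, hδ, H⟩ := hg ε hε
  refine ⟨δ, hδ, fun I hI hI' => lt_of_le_of_lt (Finset.sum_le_sum fun i hi => ?_) (H I hI hI')⟩
  exact h _ (hI.1 i hi).1 _ (hI.1 i hi).2

theorem intervalIntegrable_sub_of_mem {F : Type*} [NormedAddCommGroup F] {L : ℝ} {f : ℝ → F}
    {x y : ℝ} (hf : IntervalIntegrable f volume 0 L) (hx : x ∈ Icc 0 L) (hy : y ∈ Icc 0 L) :
    IntervalIntegrable f volume x y :=
  hf.mono_set ((uIcc_subset_Icc hx hy).trans Icc_subset_uIcc)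

variable {F : Type*} [NormedAddCommGroup F] [NormedSpace ℝ F] {L : ℝ}

theorem absolutelyContinuousOnInterval_primitive {f : ℝ → F} (hL : 0 ≤ L)
    (hf : IntervalIntegrable f volume 0 L) (c : F) :
    AbsolutelyContinuousOnInterval (fun x => c + ∫ t in 0..x, f t) 0 L := by
  refine (hf.norm.absolutelyContinuousOnInterval_intervalIntegral
    (left_mem_uIcc : (0 : ℝ) ∈ uIcc 0 L)).of_dist_le fun x hx y hy => ?_
  rw [uIcc_of_le hL] at hx hy
  have h0 : (0 : ℝ) ∈ Icc 0 L := ⟨le_rfl, hL⟩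
  rw [dist_add_left, dist_eq_norm, dist_eq_norm,
    intervalIntegral.integral_interval_sub_left (intervalIntegrable_sub_of_mem hf h0 hx)
      (intervalIntegrable_sub_of_mem hf h0 hy),
    intervalIntegral.integral_interval_sub_left (intervalIntegrable_sub_of_mem hf.norm h0 hx)
      (intervalIntegrable_sub_of_mem hf.norm h0 hy)]
  exact intervalIntegral.norm_integral_le_abs_integral_norm

theorem ae_hasDerivWithinAt_primitive [CompleteSpace F] {f : ℝ → F} (hL : 0 ≤ L)
    (hf : IntervalIntegrable f volume 0 L) (c : F) :
    ∀ᵐ x ∂volume.restrict (Icc 0 L),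
      HasDerivWithinAt (fun x => c + ∫ t in 0..x, f t) (f x) (Icc 0 L) x := by
  rw [ae_restrict_iff' measurableSet_Icc]
  filter_upwards [hf.ae_hasDerivAt_integral] with x hx hxL
  exact ((hx (by rwa [uIcc_of_le hL]) 0 left_mem_uIcc).const_add c).hasDerivWithinAt

/-- The fundamental theorem of calculus for absolutely continuous functions with values in a Banach
space, when the derivative is known to exist almost everywhere. -/
theorem AbsolutelyContinuousOnInterval.eq_add_integral [CompleteSpace F] {f f' : ℝ → F}
    (hL : 0 ≤ L) (hf : AbsolutelyContinuousOnInterval f 0 L)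
    (hf' : IntervalIntegrable f' volume 0 L)
    (hd : ∀ᵐ x ∂volume.restrict (Icc 0 L), HasDerivWithinAt f (f' x) (Icc 0 L) x) :
    ∀ x ∈ Icc 0 L, f x = f 0 + ∫ t in 0..x, f' t := by
  have h1 := hf.sub (absolutelyContinuousOnInterval_primitive hL hf' 0)
  have h2 : ∀ᵐ x, x ∈ uIcc 0 L →
      HasDerivAt (f - fun x => 0 + ∫ t in 0..x, f' t) 0 x := by
    have hd' := hd
    have hp := ae_hasDerivWithinAt_primitive hL hf' 0
    rw [ae_restrict_iff' measurableSet_Icc] at hd' hp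
    have e0 : ∀ᵐ x : ℝ, x ≠ 0 := by simp [ae_iff, measure_singleton]
    have e1 : ∀ᵐ x : ℝ, x ≠ L := by simp [ae_iff, measure_singleton]
    filter_upwards [hd', hp, e0, e1] with x h3 h4 h5 h6 hx
    rw [uIcc_of_le hL] at hx
    have hnhds : Icc 0 L ∈ 𝓝 x :=
      Icc_mem_nhds (lt_of_le_of_ne hx.1 (Ne.symm h5)) (lt_of_le_of_ne hx.2 h6)
    have := ((h3 hx).hasDerivAt hnhds).sub ((h4 hx).hasDerivAt hnhds)
    rwa [sub_self] at this
  obtain ⟨C, hC⟩ := h1.const_of_ae_hasDerivAt_zero h2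
  intro x hx
  have h3 := hC 0 left_mem_uIcc
  have h4 := hC x (by rwa [uIcc_of_le hL])
  simp only [Pi.sub_apply, intervalIntegral.integral_same, sub_zero, zero_add] at h3 h4
  rw [h3, ← h4]
  abel

theorem AbsolutelyContinuousOnInterval.pow' {f : ℝ → ℝ} {a b : ℝ}
    (hf : AbsolutelyContinuousOnInterval f a b) (n : ℕ) :
    AbsolutelyContinuousOnInterval (fun x => f x ^ (n + 1)) a b := by
  induction n with
  | zero => simpa using hf
  | succ n ih =>
    have := ih.mul hf
    simp only [pow_succ] at this ⊢
    exact this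

theorem integral_mul_primitive_pow {m : ℝ → ℝ} (hL : 0 ≤ L)
    (hm : IntervalIntegrable m volume 0 L) (n : ℕ) {x : ℝ} (hx : x ∈ Icc 0 L) :
    ∫ t in 0..x, m t * (∫ s in 0..t, m s) ^ n = (∫ s in 0..x, m s) ^ (n + 1) / (n + 1) := by
  have hac := absolutelyContinuousOnInterval_primitive hL hm 0
  have hcont := hac.continuousOn
  simp only [zero_add] at hac hcont
  have hint : IntervalIntegrable (fun t => m t * (∫ s in 0..t, m s) ^ n) volume 0 L :=
    hm.mul_continuousOn (hcont.pow n)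
  have h := (hac.pow' n).eq_add_integral hL (hint.const_mul ((n : ℝ) + 1)) (by
    filter_upwards [ae_hasDerivWithinAt_primitive hL hm 0] with y hy
    simp only [zero_add] at hy
    have := hy.pow (n + 1)
    refine this.congr_deriv ?_
    push_cast
    ring) x hx
  rw [intervalIntegral.integral_const_mul] at h
  simp only [intervalIntegral.integral_same, ne_eq, Nat.succ_ne_zero, not_false_eq_true, zero_pow,
    zero_add] at h
  rw [h]
  field_simp

end AbsolutelyContinuous

/-! ### Volterra's integral equation -/

/-- A linear endomorphism of a Banach space whose powers are bounded by `c ^ n / n!` is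
quasi-nilpotent, so that `1 - T` is bijective. -/
theorem bijective_one_sub_of_norm_pow_le {X : Type*} [NormedAddCommGroup X] [NormedSpace ℂ X]
    [CompleteSpace X] (T : Module.End ℂ X) {c : ℝ} (hc : 0 ≤ c)
    (hT : ∀ n x, ‖(T ^ n) x‖ ≤ c ^ n / n.factorial * ‖x‖) :
    Function.Bijective ((1 : Module.End ℂ X) - T) := by
  let W : X →L[ℂ] X := T.mkContinuous c fun x => by simpa using hT 1 x
  have hWT : ∀ n x, (W ^ n) x = (T ^ n) x := by
    intro n
    induction n with
    | zero => intro x; rfl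
    | succ n ih =>
      intro x
      rw [pow_succ, pow_succ, mul_apply_eq_comp, Module.End.mul_apply, ih]
      rfl
  obtain ⟨n, hn⟩ : ∃ n : ℕ, c ^ n / n.factorial < 1 :=
    ((FloorSemiring.tendsto_pow_div_factorial_atTop c).eventually_lt_const one_pos).exists
  have hWn : ‖W ^ n‖ < 1 := by
    refine lt_of_le_of_lt (ContinuousLinearMap.opNorm_le_bound _ (by positivity) fun x => ?_) hn
    rw [hWT]
    exact hT n x
  have hunit : IsUnit (1 - W) := by
    have h1 := isUnit_one_sub_of_norm_lt_one hWn
    rw [← mul_neg_geom_sum] at h1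
    refine ((Commute.isUnit_mul_iff ?_).1 h1).1
    exact Commute.sum_right _ _ _ fun i _ =>
      ((Commute.one_left _).sub_left (Commute.refl W)).pow_right i
  obtain ⟨U, hU⟩ := hunit
  have hWU : ∀ x, ((1 : Module.End ℂ X) - T) x = (U : X →L[ℂ] X) x := by
    intro x
    rw [hU]
    rfl
  refine ⟨fun x y h => ?_, fun y => ⟨(↑U⁻¹ : X →L[ℂ] X) y, ?_⟩⟩
  · rw [hWU, hWU] at h
    have h2 := congrArg (↑U⁻¹ : X →L[ℂ] X) h
    rw [← mul_apply_eq_comp, ← mul_apply_eq_comp, U.inv_mul] at h2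
    exact h2
  · rw [hWU, ← mul_apply_eq_comp, U.mul_inv]
    rfl

section Volterra

variable {L : ℝ}

/-- The integral operator `Y ↦ ∫₀ˣ (Y₂, p Y₁)` on continuous functions with values in `ℂ²`, the
fixed-point operator of the first-order system for `y'' = p y`. -/
noncomputable def volterra (hL : 0 ≤ L) (p : ℝ → ℂ) (hp : IntervalIntegrable p volume 0 L) :
    C(Icc 0 L, ℂ × ℂ) →ₗ[ℂ] C(Icc 0 L, ℂ × ℂ) where
  toFun Y :=
    { toFun := fun x => (∫ t in 0..(x : ℝ), (IccExtend hL Y t).2,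
        ∫ t in 0..(x : ℝ), p t * (IccExtend hL Y t).1)
      continuous_toFun := by
        have hY : Continuous (IccExtend hL Y) := Y.continuous.Icc_extend'
        refine Continuous.prodMk ?_ ?_
        · have h := (absolutelyContinuousOnInterval_primitive hL
            (hY.snd.intervalIntegrable 0 L) 0).continuousOn
          simp only [zero_add, uIcc_of_le hL] at h
          exact h.domRestrict
        · have h := (absolutelyContinuousOnInterval_primitive hL
            (hp.mul_continuousOn hY.fst.continuousOn) 0).continuousOn
          simp only [zero_add, uIcc_of_le hL] at h
          exact h.domRestrict }
  map_add' Y Z := by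
    have hY : Continuous (IccExtend hL Y) := Y.continuous.Icc_extend'
    have hZ : Continuous (IccExtend hL Z) := Z.continuous.Icc_extend'
    have h0 : (0 : ℝ) ∈ Icc 0 L := ⟨le_rfl, hL⟩
    ext x
    · simp only [ContinuousMap.coe_mk, ContinuousMap.add_apply, Prod.fst_add]
      rw [← intervalIntegral.integral_add (hY.snd.intervalIntegrable _ _)
        (hZ.snd.intervalIntegrable _ _)]
      rfl
    · simp only [ContinuousMap.coe_mk, ContinuousMap.add_apply, Prod.snd_add]
      have hpx := intervalIntegrable_sub_of_mem hp h0 x.2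
      rw [← intervalIntegral.integral_add (hpx.mul_continuousOn hY.fst.continuousOn)
        (hpx.mul_continuousOn hZ.fst.continuousOn)]
      refine intervalIntegral.integral_congr fun t _ => ?_
      exact mul_add _ _ _
  map_smul' c Y := by
    ext x
    · simp only [ContinuousMap.coe_mk, ContinuousMap.smul_apply, Prod.smul_fst, RingHom.id_apply,
        smul_eq_mul]
      rw [← intervalIntegral.integral_const_mul]
      rfl
    · simp only [ContinuousMap.coe_mk, ContinuousMap.smul_apply, Prod.smul_snd, RingHom.id_apply,
        smul_eq_mul]
      rw [← intervalIntegral.integral_const_mul]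
      refine intervalIntegral.integral_congr fun t _ => ?_
      exact mul_left_comm _ _ _

variable (hL : 0 ≤ L) (p : ℝ → ℂ) (hp : IntervalIntegrable p volume 0 L)

theorem norm_volterra_apply_le {Y : C(Icc 0 L, ℂ × ℂ)} {c : ℝ} {n : ℕ}
    (hY : ∀ t : Icc 0 L, ‖Y t‖ ≤ c * (∫ s in 0..(t : ℝ), (1 + ‖p s‖)) ^ n) (x : Icc 0 L) :
    ‖volterra hL p hp Y x‖ ≤ c * ((∫ s in 0..(x : ℝ), (1 + ‖p s‖)) ^ (n + 1) / (n + 1)) := by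
  have hm : IntervalIntegrable (fun s => 1 + ‖p s‖) volume 0 L :=
    intervalIntegrable_const.add hp.norm
  have hcont := (absolutelyContinuousOnInterval_primitive hL hm 0).continuousOn
  simp only [zero_add] at hcont
  have h0 : (0 : ℝ) ∈ Icc 0 L := ⟨le_rfl, hL⟩
  have hint : IntervalIntegrable
      (fun t => c * ((1 + ‖p t‖) * (∫ s in 0..t, (1 + ‖p s‖)) ^ n)) volume 0 x :=
    intervalIntegrable_sub_of_mem ((hm.mul_continuousOn (hcont.pow n)).const_mul c) h0 x.2
  rw [← integral_mul_primitive_pow hL hm n x.2, ← intervalIntegral.integral_const_mul]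
  have hext : ∀ t ∈ Ioc 0 (x : ℝ),
      ‖IccExtend hL Y t‖ ≤ c * (∫ s in 0..t, (1 + ‖p s‖)) ^ n := by
    intro t ht
    have htL : t ∈ Icc 0 L := ⟨ht.1.le, ht.2.trans x.2.2⟩
    rw [IccExtend_of_mem hL Y htL]
    exact hY ⟨t, htL⟩
  refine max_le ?_ ?_
  · refine intervalIntegral.norm_integral_le_of_norm_le x.2.1 (ae_of_all _ fun t ht => ?_) hint
    have h1 := hext t ht
    have h2 := (norm_snd_le (IccExtend hL Y t)).trans h1
    nlinarith [norm_nonneg (p t), norm_nonneg (IccExtend hL Y t)]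
  · refine intervalIntegral.norm_integral_le_of_norm_le x.2.1 (ae_of_all _ fun t ht => ?_) hint
    have h1 := hext t ht
    have h2 := (norm_fst_le (IccExtend hL Y t)).trans h1
    rw [norm_mul]
    nlinarith [norm_nonneg (p t), norm_nonneg (IccExtend hL Y t),
      mul_le_mul_of_nonneg_left h2 (norm_nonneg (p t))]

theorem norm_volterra_pow_apply_le (n : ℕ) (Y : C(Icc 0 L, ℂ × ℂ)) (x : Icc 0 L) :
    ‖(volterra hL p hp ^ n) Y x‖ ≤
      ‖Y‖ / n.factorial * (∫ s in 0..(x : ℝ), (1 + ‖p s‖)) ^ n := by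
  induction n generalizing x with
  | zero => simpa using Y.norm_coe_le_norm x
  | succ n ih =>
    rw [pow_succ', Module.End.mul_apply]
    refine (norm_volterra_apply_le hL p hp ih x).trans_eq ?_
    rw [Nat.factorial_succ]
    push_cast
    field_simp

theorem bijective_one_sub_volterra : Function.Bijective
    ((1 : Module.End ℂ C(Icc 0 L, ℂ × ℂ)) - volterra hL p hp) := by
  set V := volterra hL p hp with hV
  set c := ∫ s in 0..L, (1 + ‖p s‖) with hc
  have hm : IntervalIntegrable (fun s => 1 + ‖p s‖) volume 0 L :=
    intervalIntegrable_const.add hp.norm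
  have hc0 : 0 ≤ c := intervalIntegral.integral_nonneg hL fun t _ => by positivity
  have hbound : ∀ n Y, ‖(V ^ n) Y‖ ≤ c ^ n / n.factorial * ‖Y‖ := by
    intro n Y
    refine (ContinuousMap.norm_le _ (by positivity)).2 fun x => ?_
    refine (norm_volterra_pow_apply_le hL p hp n Y x).trans ?_
    rw [div_mul_eq_mul_div, div_mul_eq_mul_div, mul_comm]
    gcongr
    · exact intervalIntegral.integral_nonneg x.2.1 fun t _ => by positivity
    · refine intervalIntegral.integral_mono_interval le_rfl x.2.1 x.2.2
        (ae_of_all _ fun t => ?_) hm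
      simp only [Pi.zero_apply]
      positivity
  exact bijective_one_sub_of_norm_pow_le V hc0 hbound

end Volterra

/-! ### The Cauchy problem on an edge -/

section EdgeSolution

variable {L : ℝ}

theorem intervalIntegrable_of_Lp (hL : 0 ≤ L) (g : Lp ℂ 2 (volume.restrict (Icc 0 L))) :
    IntervalIntegrable g volume 0 L :=
  (intervalIntegrable_iff_integrableOn_Icc_of_le hL).2
    ((Lp.memLp g).integrable one_le_two)

theorem intervalIntegral_congr_of_ae_restrict {f g : ℝ → ℂ}
    (h : f =ᵐ[volume.restrict (Icc 0 L)] g) {x : ℝ} (hx : x ∈ Icc 0 L) :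
    ∫ t in 0..x, f t = ∫ t in 0..x, g t := by
  rw [intervalIntegral.integral_of_le hx.1, intervalIntegral.integral_of_le hx.1]
  have hsub : Ioc 0 x ⊆ Icc 0 L := fun t ht => ⟨ht.1.le, ht.2.trans hx.2⟩
  exact integral_congr_ae (ae_restrict_of_ae_restrict_of_subset hsub h)

/-- The function `x ↦ (a, b - ∫₀ˣ g)`, the inhomogeneous term of the integral equation. -/
noncomputable def forcing (hL : 0 ≤ L) :
    (Lp ℂ 2 (volume.restrict (Icc 0 L)) × ℂ × ℂ) →ₗ[ℂ] C(Icc 0 L, ℂ × ℂ) where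
  toFun y :=
    { toFun := fun x => (y.2.1, y.2.2 - ∫ t in 0..(x : ℝ), y.1 t)
      continuous_toFun := by
        refine Continuous.prodMk continuous_const (continuous_const.sub ?_)
        have h := (absolutelyContinuousOnInterval_primitive hL
          (intervalIntegrable_of_Lp hL y.1) 0).continuousOn
        simp only [zero_add, uIcc_of_le hL] at h
        exact h.domRestrict }
  map_add' y z := by
    have h0 : (0 : ℝ) ∈ Icc 0 L := ⟨le_rfl, hL⟩
    ext x
    · rfl
    · simp only [ContinuousMap.coe_mk, ContinuousMap.add_apply, Prod.snd_add, Prod.fst_add]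
      rw [intervalIntegral_congr_of_ae_restrict (Lp.coeFn_add y.1 z.1) x.2]
      simp only [Pi.add_apply]
      rw [intervalIntegral.integral_add
        (intervalIntegrable_sub_of_mem (intervalIntegrable_of_Lp hL y.1) h0 x.2)
        (intervalIntegrable_sub_of_mem (intervalIntegrable_of_Lp hL z.1) h0 x.2)]
      ring
  map_smul' c y := by
    ext x
    · rfl
    · simp only [ContinuousMap.coe_mk, ContinuousMap.smul_apply, Prod.smul_snd, Prod.smul_fst,
        RingHom.id_apply, smul_eq_mul]
      rw [intervalIntegral_congr_of_ae_restrict (Lp.coeFn_smul c y.1) x.2]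
      simp only [Pi.smul_apply, smul_eq_mul]
      rw [intervalIntegral.integral_const_mul]
      ring

/-- The pair `(y, y')` for the solution of `- y'' + p y = g` with `y 0 = a` and `y' 0 = b`, as a
linear function of `(g, a, b)`. -/
noncomputable def edgeSolution (hL : 0 ≤ L) (p : ℝ → ℂ) (hp : IntervalIntegrable p volume 0 L) :
    (Lp ℂ 2 (volume.restrict (Icc 0 L)) × ℂ × ℂ) →ₗ[ℂ] C(Icc 0 L, ℂ × ℂ) :=
  (LinearEquiv.ofBijective _ (bijective_one_sub_volterra hL p hp)).symm.toLinearMap ∘ₗ forcing hL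

variable (hL : 0 ≤ L) (p : ℝ → ℂ) (hp : IntervalIntegrable p volume 0 L)
  (y : Lp ℂ 2 (volume.restrict (Icc 0 L)) × ℂ × ℂ)

theorem edgeSolution_spec :
    edgeSolution hL p hp y = forcing hL y + volterra hL p hp (edgeSolution hL p hp y) := by
  have h : edgeSolution hL p hp y - volterra hL p hp (edgeSolution hL p hp y) = forcing hL y :=
    (LinearEquiv.ofBijective _ (bijective_one_sub_volterra hL p hp)).apply_symm_apply _
  rw [← h, sub_add_cancel]

/-- The solution on the edge, as a function on the line that is constant outside `[0, L]`. -/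
noncomputable def solVal (t : ℝ) : ℂ := (IccExtend hL (edgeSolution hL p hp y) t).1

/-- The derivative of the solution on the edge, as a function on the line that is constant outside
`[0, L]`. -/
noncomputable def solDer (t : ℝ) : ℂ := (IccExtend hL (edgeSolution hL p hp y) t).2

theorem continuous_solVal : Continuous (solVal hL p hp y) :=
  (edgeSolution hL p hp y).continuous.Icc_extend'.fst

theorem continuous_solDer : Continuous (solDer hL p hp y) :=
  (edgeSolution hL p hp y).continuous.Icc_extend'.snd

theorem intervalIntegrable_rhs :
    IntervalIntegrable (fun t => p t * solVal hL p hp y t - y.1 t) volume 0 L :=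
  (hp.mul_continuousOn (continuous_solVal hL p hp y).continuousOn).sub
    (intervalIntegrable_of_Lp hL y.1)

theorem solVal_eq {x : ℝ} (hx : x ∈ Icc 0 L) :
    solVal hL p hp y x = y.2.1 + ∫ t in 0..x, solDer hL p hp y t := by
  rw [solVal, IccExtend_of_mem hL _ hx, edgeSolution_spec]
  rfl

theorem solDer_eq {x : ℝ} (hx : x ∈ Icc 0 L) :
    solDer hL p hp y x = y.2.2 + ∫ t in 0..x, (p t * solVal hL p hp y t - y.1 t) := by
  have h0 : (0 : ℝ) ∈ Icc 0 L := ⟨le_rfl, hL⟩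
  rw [intervalIntegral.integral_sub
    (intervalIntegrable_sub_of_mem
      (hp.mul_continuousOn (continuous_solVal hL p hp y).continuousOn) h0 hx)
    (intervalIntegrable_sub_of_mem (intervalIntegrable_of_Lp hL y.1) h0 hx)]
  rw [solDer, IccExtend_of_mem hL _ hx, edgeSolution_spec]
  change (y.2.2 - ∫ t in 0..x, y.1 t) + ∫ t in 0..x, p t * solVal hL p hp y t = _
  ring

theorem solVal_zero : solVal hL p hp y 0 = y.2.1 := by
  simpa using solVal_eq hL p hp y (x := 0) ⟨le_rfl, hL⟩

theorem solDer_zero : solDer hL p hp y 0 = y.2.2 := by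
  simpa using solDer_eq hL p hp y (x := 0) ⟨le_rfl, hL⟩

theorem hasDerivWithinAt_solVal {x : ℝ} (hx : x ∈ Icc 0 L) :
    HasDerivWithinAt (solVal hL p hp y) (solDer hL p hp y x) (Icc 0 L) x := by
  have hc := continuous_solDer hL p hp y
  have h : HasDerivAt (fun x => y.2.1 + ∫ t in 0..x, solDer hL p hp y t) (solDer hL p hp y x) x :=
    (intervalIntegral.integral_hasDerivAt_right (hc.intervalIntegrable _ _)
      hc.stronglyMeasurable.stronglyMeasurableAtFilter hc.continuousAt).const_add _
  exact h.hasDerivWithinAt.congr (fun t ht => solVal_eq hL p hp y ht) (solVal_eq hL p hp y hx)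

theorem ae_hasDerivWithinAt_solDer :
    ∀ᵐ x ∂volume.restrict (Icc 0 L), HasDerivWithinAt (solDer hL p hp y)
      (p x * solVal hL p hp y x - y.1 x) (Icc 0 L) x := by
  filter_upwards [ae_hasDerivWithinAt_primitive hL (intervalIntegrable_rhs hL p hp y) y.2.2,
    ae_restrict_mem measurableSet_Icc] with x hx hmem
  exact hx.congr (fun t ht => solDer_eq hL p hp y ht) (solDer_eq hL p hp y hmem)

theorem absolutelyContinuousOnInterval_solVal :
    AbsolutelyContinuousOnInterval (solVal hL p hp y) 0 L :=
  MetricGraph.acOn_congr hL (absolutelyContinuousOnInterval_primitive hL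
    ((continuous_solDer hL p hp y).intervalIntegrable _ _) y.2.1)
    fun _ ht => solVal_eq hL p hp y ht

theorem absolutelyContinuousOnInterval_solDer :
    AbsolutelyContinuousOnInterval (solDer hL p hp y) 0 L :=
  MetricGraph.acOn_congr hL (absolutelyContinuousOnInterval_primitive hL
    (intervalIntegrable_rhs hL p hp y) y.2.2) fun _ ht => solDer_eq hL p hp y ht

variable {y}

/-- Uniqueness for the Cauchy problem: a pair `(u, u')` that solves the differential equation almost
everywhere solves the integral equation. -/
theorem eqOn_solVal_solDer {u u' : ℝ → ℂ} (hu : ContinuousOn u (Icc 0 L))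
    (hu' : AbsolutelyContinuousOnInterval u' 0 L)
    (hd : ∀ x ∈ Icc 0 L, HasDerivWithinAt u (u' x) (Icc 0 L) x)
    (hd' : ∀ᵐ x ∂volume.restrict (Icc 0 L), HasDerivWithinAt u' (p x * u x - y.1 x) (Icc 0 L) x)
    (h0 : u 0 = y.2.1) (h0' : u' 0 = y.2.2) :
    EqOn u (solVal hL p hp y) (Icc 0 L) ∧ EqOn u' (solDer hL p hp y) (Icc 0 L) := by
  have hz : (0 : ℝ) ∈ Icc 0 L := ⟨le_rfl, hL⟩
  have hcu' : ContinuousOn u' (Icc 0 L) := by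
    have := hu'.continuousOn
    rwa [uIcc_of_le hL] at this
  have huu : IntervalIntegrable (fun x => p x * u x) volume 0 L :=
    hp.mul_continuousOn (by rwa [uIcc_of_le hL])
  have hu'int : IntervalIntegrable u' volume 0 L :=
    ContinuousOn.intervalIntegrable (by rwa [uIcc_of_le hL])
  have e1 : ∀ x ∈ Icc 0 L, u x = y.2.1 + ∫ t in 0..x, u' t := by
    intro x hx
    have := intervalIntegral.integral_eq_sub_of_hasDeriv_right_of_le hx.1
      (hu.mono (Icc_subset_Icc_right hx.2))
      (fun t ht => ((hd t ⟨ht.1.le, ht.2.le.trans hx.2⟩).hasDerivAt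
        (Icc_mem_nhds ht.1 (ht.2.trans_le hx.2))).hasDerivWithinAt)
      (intervalIntegrable_sub_of_mem hu'int hz hx)
    rw [this, h0]
    ring
  have e2 := hu'.eq_add_integral hL (huu.sub (intervalIntegrable_of_Lp hL y.1)) hd'
  let Y : C(Icc 0 L, ℂ × ℂ) :=
    ⟨fun x => (u x, u' x), (hu.domRestrict).prodMk hcu'.domRestrict⟩
  have hYext : ∀ x (hx : x ∈ Icc 0 L), IccExtend hL Y x = (u x, u' x) := fun x hx =>
    IccExtend_of_mem hL Y hx
  have hY : edgeSolution hL p hp y = Y := by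
    refine (LinearEquiv.symm_apply_eq _).2 ?_
    rw [LinearEquiv.ofBijective_apply, LinearMap.sub_apply, Module.End.one_apply, eq_sub_iff_add_eq]
    ext x
    · change y.2.1 + ∫ t in 0..(x : ℝ), (IccExtend hL Y t).2 = u x
      rw [e1 x x.2]
      congr 1
      refine intervalIntegral.integral_congr fun t ht => ?_
      rw [uIcc_of_le x.2.1] at ht
      simp only [hYext t ⟨ht.1, ht.2.trans x.2.2⟩]
    · change (y.2.2 - ∫ t in 0..(x : ℝ), y.1 t) +
        ∫ t in 0..(x : ℝ), p t * (IccExtend hL Y t).1 = u' x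
      have e3 : ∫ t in 0..(x : ℝ), p t * (IccExtend hL Y t).1 = ∫ t in 0..(x : ℝ), p t * u t := by
        refine intervalIntegral.integral_congr fun t ht => ?_
        rw [uIcc_of_le x.2.1] at ht
        simp only [hYext t ⟨ht.1, ht.2.trans x.2.2⟩]
      rw [e2 x x.2, e3, h0', intervalIntegral.integral_sub
        (intervalIntegrable_sub_of_mem huu hz x.2)
        (intervalIntegrable_sub_of_mem (intervalIntegrable_of_Lp hL y.1) hz x.2)]
      ring
  constructor
  · intro x hx
    rw [solVal, hY, hYext x hx]
  · intro x hx
    rw [solDer, hY, hYext x hx]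

open ComplexConjugate in
/-- Green's formula on an edge, for a real potential: the derivative of the Wronskian
`conj u' * v - conj u * v'` is `conj u * g₂ - conj g₁ * v`. -/
theorem green_edge (hreal : ∀ x, conj (p x) = p x)
    (y z : Lp ℂ 2 (volume.restrict (Icc 0 L)) × ℂ × ℂ) :
    ∫ x in Icc 0 L, (conj (solVal hL p hp y x) * z.1 x - conj (y.1 x) * solVal hL p hp z x) =
      (conj (solDer hL p hp y L) * solVal hL p hp z L -
        conj (solVal hL p hp y L) * solDer hL p hp z L) -
      (conj (solDer hL p hp y 0) * solVal hL p hp z 0 -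
        conj (solVal hL p hp y 0) * solDer hL p hp z 0) := by
  have hconj : ∀ {f : ℝ → ℂ}, AbsolutelyContinuousOnInterval f 0 L →
      AbsolutelyContinuousOnInterval (fun x => conj (f x)) 0 L := fun hf =>
    hf.of_dist_le fun x _ x' _ => by
      rw [dist_eq_norm, dist_eq_norm, ← map_sub, RCLike.norm_conj]
  have hac := ((hconj (absolutelyContinuousOnInterval_solDer hL p hp y)).smul
    (absolutelyContinuousOnInterval_solVal hL p hp z)).sub
    ((hconj (absolutelyContinuousOnInterval_solVal hL p hp y)).smul
    (absolutelyContinuousOnInterval_solDer hL p hp z))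
  have hint : IntervalIntegrable (fun x => conj (solVal hL p hp y x) * z.1 x -
      conj (y.1 x) * solVal hL p hp z x) volume 0 L := by
    refine ((intervalIntegrable_of_Lp hL z.1).continuousOn_mul
      (Complex.continuous_conj.comp (continuous_solVal hL p hp y)).continuousOn).sub
      (IntervalIntegrable.mul_continuousOn ?_ (continuous_solVal hL p hp z).continuousOn)
    have h := intervalIntegrable_of_Lp hL y.1
    exact h.norm.mono_fun (by
      exact Complex.continuous_conj.comp_aestronglyMeasurable h.aestronglyMeasurable_restrict_uIoc)
      (ae_of_all _ fun x => by simp)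
  have h := hac.eq_add_integral hL hint (by
    filter_upwards [ae_hasDerivWithinAt_solDer hL p hp y, ae_hasDerivWithinAt_solDer hL p hp z,
      ae_restrict_mem measurableSet_Icc] with x hy hz hx
    have h1 := hasDerivWithinAt_solVal hL p hp y hx
    have h2 := hasDerivWithinAt_solVal hL p hp z hx
    have h3 : HasDerivWithinAt (fun x => conj (solDer hL p hp y x)) _ (Icc 0 L) x := hy.star
    have h4 : HasDerivWithinAt (fun x => conj (solVal hL p hp y x)) _ (Icc 0 L) x := h1.star
    refine ((h3.mul h2).sub (h4.mul hz)).congr_deriv ?_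
    simp only [starRingEnd_apply, star_sub, star_mul']
    have := hreal x
    rw [starRingEnd_apply] at this
    rw [this]
    ring) L ⟨hL, le_rfl⟩
  rw [intervalIntegral.integral_of_le hL, ← integral_Icc_eq_integral_Ioc] at h
  rw [eq_sub_iff_add_eq']
  exact h.symm

/-- A solution of the homogeneous equation with vanishing Cauchy data at the right endpoint
vanishes, because its Wronskian with every other solution is constant. -/
theorem eq_zero_of_solVal_solDer_right (hreal : ∀ x, starRingEnd ℂ (p x) = p x) {a b : ℂ}
    (h : solVal hL p hp (0, a, b) L = 0) (h' : solDer hL p hp (0, a, b) L = 0) :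
    a = 0 ∧ b = 0 := by
  have key : ∀ c d : ℂ, starRingEnd ℂ b * c - starRingEnd ℂ a * d = 0 := by
    intro c d
    have hg := green_edge hL p hp hreal (0, a, b) (0, c, d)
    rw [h, h', solVal_zero, solDer_zero, solVal_zero, solDer_zero] at hg
    have h0 : ∫ x in Icc 0 L, (starRingEnd ℂ (solVal hL p hp (0, a, b) x) *
        (0 : Lp ℂ 2 (volume.restrict (Icc 0 L))) x -
        starRingEnd ℂ ((0 : Lp ℂ 2 (volume.restrict (Icc 0 L))) x) *
          solVal hL p hp (0, c, d) x) = 0 := by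
      rw [← integral_zero ℝ ℂ (μ := volume.restrict (Icc 0 L))]
      refine integral_congr_ae ?_
      filter_upwards [Lp.coeFn_zero ℂ 2 (volume.restrict (Icc 0 L))] with x hx
      simp only [hx, Pi.zero_apply, map_zero, mul_zero, zero_mul, sub_zero]
    rw [h0] at hg
    simp only [map_zero, zero_mul, sub_zero, zero_sub] at hg
    linear_combination hg
  have h1 := key 1 0
  have h2 := key 0 1
  simp only [mul_one, mul_zero, sub_zero, zero_sub, neg_eq_zero, map_eq_zero] at h1 h2
  exact ⟨h2, h1⟩

end EdgeSolution

/-! ### Boundary value problems on a metric graph -/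

theorem ContinuousOn.memLp_restrict_Icc {f : ℝ → ℂ} {a b : ℝ} (hf : ContinuousOn f (Icc a b)) :
    MemLp f 2 (volume.restrict (Icc a b)) := by
  obtain ⟨C, hC⟩ := isCompact_Icc.exists_bound_of_continuousOn hf
  exact MemLp.of_bound (hf.aestronglyMeasurable measurableSet_Icc) C
    ((ae_restrict_iff' measurableSet_Icc).2 (ae_of_all _ hC))

namespace MetricGraph

variable {V E : Type*} (G : MetricGraph V E)

/-- The potential `q - lam`, complex valued. -/
noncomputable def shiftedPotential (q : E → ℝ → ℝ) (lam : ℝ) (e : E) (t : ℝ) : ℂ :=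
  ((q e t - lam : ℝ) : ℂ)

theorem intervalIntegrable_shiftedPotential {q : E → ℝ → ℝ}
    (hq : ∀ e, IntegrableOn (q e) (Icc 0 (G.length e))) (lam : ℝ) (e : E) :
    IntervalIntegrable (shiftedPotential q lam e) volume 0 (G.length e) := by
  rw [intervalIntegrable_iff_integrableOn_Icc_of_le (G.length_pos e).le]
  have h : IntegrableOn (fun t => q e t - lam) (Icc 0 (G.length e)) :=
    (hq e).sub (integrableOn_const (by simp))
  exact h.ofReal

variable (q : E → ℝ → ℝ) (hq : ∀ e, IntegrableOn (q e) (Icc 0 (G.length e))) (lam : ℝ)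

/-- The data `(g, c, w)` of a boundary value problem on the graph: the right-hand side `g`, the
Cauchy data `c e` of the solution at the endpoint `0` of each edge `e`, and the prospective values
`w v` of the solution at the vertices. -/
abbrev BVPData : Type _ := G.L2 × (E → ℂ × ℂ) × (V → ℂ)

/-- The edgewise solution of `- f'' + q f - lam f = g` with the given Cauchy data. -/
noncomputable def solFun : G.BVPData →ₗ[ℂ] (E → ℝ → ℂ) where
  toFun x e := solVal (G.length_pos e).le _ (G.intervalIntegrable_shiftedPotential hq lam e)
    (x.1 e, x.2.1 e)
  map_add' x y := by
    funext e t
    exact congrArg (fun Y : C(Icc 0 (G.length e), ℂ × ℂ) =>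
      (IccExtend (G.length_pos e).le Y t).1) (map_add (edgeSolution (G.length_pos e).le _
        (G.intervalIntegrable_shiftedPotential hq lam e)) (x.1 e, x.2.1 e) (y.1 e, y.2.1 e))
  map_smul' c x := by
    funext e t
    exact congrArg (fun Y : C(Icc 0 (G.length e), ℂ × ℂ) =>
      (IccExtend (G.length_pos e).le Y t).1) (map_smul (edgeSolution (G.length_pos e).le _
        (G.intervalIntegrable_shiftedPotential hq lam e)) c (x.1 e, x.2.1 e))

/-- The derivative of `solFun`. -/
noncomputable def solDeriv : G.BVPData →ₗ[ℂ] (E → ℝ → ℂ) where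
  toFun x e := solDer (G.length_pos e).le _ (G.intervalIntegrable_shiftedPotential hq lam e)
    (x.1 e, x.2.1 e)
  map_add' x y := by
    funext e t
    exact congrArg (fun Y : C(Icc 0 (G.length e), ℂ × ℂ) =>
      (IccExtend (G.length_pos e).le Y t).2) (map_add (edgeSolution (G.length_pos e).le _
        (G.intervalIntegrable_shiftedPotential hq lam e)) (x.1 e, x.2.1 e) (y.1 e, y.2.1 e))
  map_smul' c x := by
    funext e t
    exact congrArg (fun Y : C(Icc 0 (G.length e), ℂ × ℂ) =>
      (IccExtend (G.length_pos e).le Y t).2) (map_smul (edgeSolution (G.length_pos e).le _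
        (G.intervalIntegrable_shiftedPotential hq lam e)) c (x.1 e, x.2.1 e))

variable (x : G.BVPData)

theorem edgeDeriv_solFun (e : E) :
    EqOn (G.edgeDeriv (G.solFun q hq lam x) e) (G.solDeriv q hq lam x e) (G.interval e) :=
  fun t ht => (hasDerivWithinAt_solVal (G.length_pos e).le _
    (G.intervalIntegrable_shiftedPotential hq lam e) _ ht).derivWithin (uniqueDiffOn e t ht)

theorem continuous_solFun (e : E) : Continuous (G.solFun q hq lam x e) :=
  continuous_solVal _ _ _ _

theorem isL2_solFun : G.IsL2 (G.solFun q hq lam x) := fun e =>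
  (G.continuous_solFun q hq lam x e).continuousOn.memLp_restrict_Icc

theorem isAC2_solFun : G.IsAC2 (G.solFun q hq lam x) := fun e =>
  ⟨fun _ ht => (hasDerivWithinAt_solVal (G.length_pos e).le _
    (G.intervalIntegrable_shiftedPotential hq lam e) _ ht).differentiableWithinAt,
    absolutelyContinuousOnInterval_solVal _ _ _ _,
    acOn_congr (G.length_pos e).le (absolutelyContinuousOnInterval_solDer (G.length_pos e).le _
      (G.intervalIntegrable_shiftedPotential hq lam e) _) (G.edgeDeriv_solFun q hq lam x e)⟩

theorem schrodinger_solFun (e : E) :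
    G.schrodinger q (G.solFun q hq lam x) e =ᵐ[volume.restrict (G.interval e)]
      fun t => (lam : ℂ) * G.solFun q hq lam x e t + x.1 e t := by
  filter_upwards [ae_hasDerivWithinAt_solDer (G.length_pos e).le _
    (G.intervalIntegrable_shiftedPotential hq lam e) (x.1 e, x.2.1 e),
    ae_restrict_mem (measurableSet_Icc (a := (0 : ℝ)) (b := G.length e))] with t ht hmem
  have h1 := (ht.congr (fun s hs => G.edgeDeriv_solFun q hq lam x e hs)
    (G.edgeDeriv_solFun q hq lam x e hmem)).derivWithin (uniqueDiffOn e t hmem)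
  have h2 : derivWithin (G.edgeDeriv (G.solFun q hq lam x) e) (G.interval e) t =
      shiftedPotential q lam e t * G.solFun q hq lam x e t - x.1 e t := h1
  rw [schrodinger, h2, shiftedPotential]
  push_cast
  ring

/-- The class in `L²(G)` of the edgewise solution. -/
noncomputable def solL2 : G.BVPData →ₗ[ℂ] G.L2 where
  toFun x := WithLp.toLp 2 fun e => (G.isL2_solFun q hq lam x e).toLp
  map_add' x y := by
    ext1 e
    refine (MemLp.toLp_congr (G.isL2_solFun q hq lam (x + y) e)
      ((G.isL2_solFun q hq lam x e).add (G.isL2_solFun q hq lam y e))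
      (ae_of_all _ fun t => ?_)).trans
      (MemLp.toLp_add (G.isL2_solFun q hq lam x e) (G.isL2_solFun q hq lam y e))
    rw [map_add]
    rfl
  map_smul' c x := by
    ext1 e
    refine (MemLp.toLp_congr (G.isL2_solFun q hq lam (c • x) e)
      ((G.isL2_solFun q hq lam x e).const_smul c) (ae_of_all _ fun t => ?_)).trans
      (MemLp.toLp_const_smul c (G.isL2_solFun q hq lam x e))
    rw [map_smul]
    rfl

theorem coeFn_solL2 : G.AEEqual (fun e => G.solL2 q hq lam x e) (G.solFun q hq lam x) := fun e =>
  (G.isL2_solFun q hq lam x e).coeFn_toLp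

theorem endpointValue_add (f g : E → ℝ → ℂ) (p : E × Bool) :
    G.endpointValue (f + g) p = G.endpointValue f p + G.endpointValue g p := rfl

theorem endpointValue_smul (c : ℂ) (f : E → ℝ → ℂ) (p : E × Bool) :
    G.endpointValue (c • f) p = c * G.endpointValue f p := rfl

section

variable [Fintype E] (α : V → ℝ)

/-- The defect of the edgewise solution in the vertex conditions. The first component compares the
values at the endpoints of the edges with the prospective values at the vertices; it vanishes if and
only if the solution is continuous on the graph with these values at the vertices. The second
component is the right-hand side of the condition on the normal derivatives. -/
noncomputable def defect : G.BVPData →ₗ[ℂ] (E × Bool → ℂ) × (V → ℂ) where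
  toFun x := (fun p => G.endpointValue (G.solFun q hq lam x) p - x.2.2 (G.vertexOf p),
    fun v => G.normalDeriv (G.solFun q hq lam x) v - (α v : ℂ) * x.2.2 v)
  map_add' x y := by
    ext i
    · simp only [map_add, endpointValue_add, Prod.snd_add, Prod.fst_add, Pi.add_apply]
      ring
    · simp only [map_add, normalDeriv_add (G.isAC2_solFun q hq lam x) (G.isAC2_solFun q hq lam y),
        Prod.snd_add, Pi.add_apply]
      ring
  map_smul' c x := by
    ext i
    · simp only [map_smul, endpointValue_smul, Prod.smul_snd, Prod.smul_fst, Pi.smul_apply,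
        smul_eq_mul, RingHom.id_apply]
      ring
    · simp only [map_smul, normalDeriv_smul, Prod.smul_snd, Pi.smul_apply, smul_eq_mul,
        RingHom.id_apply]
      ring

variable {G q hq lam α x}

theorem endpointValue_solFun (hx : (G.defect q hq lam α x).1 = 0) (p : E × Bool) :
    G.endpointValue (G.solFun q hq lam x) p = x.2.2 (G.vertexOf p) :=
  sub_eq_zero.1 (congrFun hx p)

theorem vertexValue_solFun (hx : (G.defect q hq lam α x).1 = 0) (v : V) :
    G.vertexValue (G.solFun q hq lam x) v = x.2.2 v := by
  rw [vertexValue, endpointValue_solFun hx]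
  exact congrArg x.2.2 (Classical.choose_spec (G.exists_endpoint v))

theorem isContinuous_solFun (hx : (G.defect q hq lam α x).1 = 0) :
    G.IsContinuous (G.solFun q hq lam x) :=
  ⟨fun e => (G.continuous_solFun q hq lam x e).continuousOn, fun p p' h => by
    rw [endpointValue_solFun hx, endpointValue_solFun hx, h]⟩

theorem normalDeriv_solFun_sub (hx : (G.defect q hq lam α x).1 = 0) (v : V) :
    G.normalDeriv (G.solFun q hq lam x) v - (α v : ℂ) * G.vertexValue (G.solFun q hq lam x) v =
      (G.defect q hq lam α x).2 v := by
  rw [vertexValue_solFun hx]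
  rfl

/-- A solution without defect lies in the domain of `A_α`, and `A_α - lam` maps it to the right-hand
side. -/
theorem solL2_mem_operatorGraph (hx : G.defect q hq lam α x = 0) :
    (G.solL2 q hq lam x, (lam : ℂ) • G.solL2 q hq lam x + x.1) ∈ G.operatorGraph q α := by
  have h1 : (G.defect q hq lam α x).1 = 0 := by rw [hx]; rfl
  have hae : ∀ e, ((lam : ℂ) • G.solL2 q hq lam x + x.1) e =ᵐ[volume.restrict (G.interval e)]
      G.schrodinger q (G.solFun q hq lam x) e := by
    intro e
    filter_upwards [G.schrodinger_solFun q hq lam x e, G.coeFn_solL2 q hq lam x e,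
      Lp.coeFn_add ((lam : ℂ) • G.solL2 q hq lam x e) (x.1 e),
      Lp.coeFn_smul (lam : ℂ) (G.solL2 q hq lam x e)] with t h2 h3 h4 h5
    rw [h2, ← h3]
    refine h4.trans ?_
    rw [Pi.add_apply, h5]
    rfl
  refine ⟨G.solFun q hq lam x, ⟨G.isL2_solFun q hq lam x, G.isAC2_solFun q hq lam x,
    fun e => (Lp.memLp _).ae_eq (hae e), isContinuous_solFun h1, fun v => ?_⟩,
    G.coeFn_solL2 q hq lam x, hae⟩
  rw [normalDeriv_solFun_sub h1, hx]
  rfl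

variable (hq lam α) in
/-- Every function on the graph that solves the equation arises as an edgewise solution. -/
theorem exists_data_of_schrodinger_eq {f : E → ℝ → ℂ} (hf : G.IsAC2 f) (hfc : G.IsContinuous f)
    {g : G.L2} (hg : ∀ e, G.schrodinger q f e =ᵐ[volume.restrict (G.interval e)]
      fun t => (lam : ℂ) * f e t + g e t) :
    ∃ c : E → ℂ × ℂ,
      (∀ e, EqOn (f e) (G.solFun q hq lam (g, c, G.vertexValue f) e) (G.interval e)) ∧
      G.defect q hq lam α (g, c, G.vertexValue f) =
        (0, fun v => G.normalDeriv f v - (α v : ℂ) * G.vertexValue f v) := by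
  set x : G.BVPData := (g, fun e => (f e 0, G.edgeDeriv f e 0), G.vertexValue f) with hx
  have heq : ∀ e, EqOn (f e) (G.solFun q hq lam x e) (G.interval e) ∧
      EqOn (G.edgeDeriv f e) (G.solDeriv q hq lam x e) (G.interval e) := by
    intro e
    refine eqOn_solVal_solDer (G.length_pos e).le _
      (G.intervalIntegrable_shiftedPotential hq lam e) (y := (x.1 e, x.2.1 e)) (hfc.1 e)
      (hf e).2.2 (fun t ht => ((hf e).1 t ht).hasDerivWithinAt) ?_ rfl rfl
    filter_upwards [hg e, ae_differentiable_edgeDeriv hf e] with t h1 h2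
    refine h2.hasDerivWithinAt.congr_deriv ?_
    rw [schrodinger] at h1
    change _ = ((q e t - lam : ℝ) : ℂ) * f e t - g e t
    push_cast
    linear_combination -h1
  refine ⟨x.2.1, fun e => (heq e).1, Prod.ext (funext fun p => ?_) (funext fun v => ?_)⟩
  · have h1 : G.endpointValue (G.solFun q hq lam x) p = G.endpointValue f p := by
      refine ((heq p.1).1 ?_).symm
      split_ifs
      exacts [length_mem_interval _, zero_mem_interval _]
    refine sub_eq_zero.2 (h1.trans (hfc.2 _ _ ?_))
    exact (Classical.choose_spec (G.exists_endpoint (G.vertexOf p))).symm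
  · classical
    have h1 : G.normalDeriv (G.solFun q hq lam x) v = G.normalDeriv f v := by
      simp only [normalDeriv]
      congr 1 <;> refine Finset.sum_congr rfl fun e _ => ?_
      · rw [G.edgeDeriv_solFun q hq lam x e (length_mem_interval e),
          (heq e).2 (length_mem_interval e)]
      · rw [G.edgeDeriv_solFun q hq lam x e (zero_mem_interval e),
          (heq e).2 (zero_mem_interval e)]
    exact congrArg (· - (α v : ℂ) * G.vertexValue f v) h1

variable (hq lam) in
theorem exists_data_of_mem_operatorGraph {u w : G.L2} (h : (u, w) ∈ G.operatorGraph q α) :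
    ∃ c : (E → ℂ × ℂ) × (V → ℂ), G.solL2 q hq lam (w - (lam : ℂ) • u, c) = u ∧
      G.defect q hq lam α (w - (lam : ℂ) • u, c) = 0 := by
  obtain ⟨f, ⟨-, h2, -, h4, h5⟩, h6, h7⟩ := h
  obtain ⟨c, hc1, hc2⟩ := exists_data_of_schrodinger_eq (α := α) hq lam h2 h4
    (g := w - (lam : ℂ) • u) (by
      intro e
      filter_upwards [h6 e, h7 e, Lp.coeFn_sub (w e) ((lam : ℂ) • u e),
        Lp.coeFn_smul (lam : ℂ) (u e)] with t h8 h9 h10 h11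
      have h12 : (w - (lam : ℂ) • u) e t = w e t - (lam : ℂ) * u e t := by
        refine h10.trans ?_
        rw [Pi.sub_apply, h11]
        rfl
      rw [h12, h8, h9]
      ring)
  refine ⟨(c, G.vertexValue f), ?_, ?_⟩
  · ext1 e
    refine Lp.ext ?_
    filter_upwards [h6 e, G.coeFn_solL2 q hq lam (w - (lam : ℂ) • u, c, G.vertexValue f) e,
      ae_restrict_mem (measurableSet_Icc (a := (0 : ℝ)) (b := G.length e))] with t h8 h9 hmem
    rw [h8, h9, hc1 e hmem]
  · rw [hc2]
    exact Prod.ext rfl (funext h5)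

theorem eq_zero_of_solL2_eq_zero (h0 : x.1 = 0) (h : G.solL2 q hq lam x = 0)
    (hx : (G.defect q hq lam α x).1 = 0) : x = 0 := by
  have h1 : ∀ e, EqOn (G.solFun q hq lam x e) 0 (G.interval e) := fun e =>
    Measure.eqOn_Icc_of_ae_eq volume (G.length_pos e).ne
      ((G.coeFn_solL2 q hq lam x e).symm.trans (by
        simp only [h]
        exact Lp.coeFn_zero _ _ _)) (G.continuous_solFun q hq lam x e).continuousOn
      continuousOn_const
  have h2 : ∀ e, EqOn (G.solDeriv q hq lam x e) 0 (G.interval e) := fun e t ht => by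
    rw [← G.edgeDeriv_solFun q hq lam x e ht, edgeDeriv, derivWithin_congr (h1 e) (h1 e ht)]
    simp
  refine Prod.ext h0 (Prod.ext (funext fun e => Prod.ext ?_ ?_) (funext fun v => ?_))
  · exact (solVal_zero _ _ _ (x.1 e, x.2.1 e)).symm.trans (h1 e (zero_mem_interval e))
  · exact (solDer_zero _ _ _ (x.1 e, x.2.1 e)).symm.trans (h2 e (zero_mem_interval e))
  · rw [← vertexValue_solFun hx]
    refine h1 _ ?_
    split_ifs
    exacts [length_mem_interval _, zero_mem_interval _]

end

end MetricGraph

/-! ### Green's formula and the Titchmarsh-Weyl matrix -/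

namespace MetricGraph

variable {V E : Type*} {G : MetricGraph V E} {q : E → ℝ → ℝ}
  {hq : ∀ e, IntegrableOn (q e) (Icc 0 (G.length e))} {lam : ℝ}

/-- The outward derivative of the edgewise solution at an endpoint of an edge. -/
noncomputable def outwardDeriv (G : MetricGraph V E) (q : E → ℝ → ℝ)
    (hq : ∀ e, IntegrableOn (q e) (Icc 0 (G.length e))) (lam : ℝ) (p : E × Bool) :
    G.BVPData →ₗ[ℂ] ℂ :=
  if p.2 then LinearMap.proj (G.length p.1) ∘ₗ LinearMap.proj p.1 ∘ₗ G.solDeriv q hq lam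
  else -(LinearMap.proj 0 ∘ₗ LinearMap.proj p.1 ∘ₗ G.solDeriv q hq lam)

theorem outwardDeriv_true (e : E) (x : G.BVPData) :
    outwardDeriv G q hq lam (e, true) x = G.solDeriv q hq lam x e (G.length e) := rfl

theorem outwardDeriv_false (e : E) (x : G.BVPData) :
    outwardDeriv G q hq lam (e, false) x = - G.solDeriv q hq lam x e 0 := rfl

variable [Fintype E] {α : V → ℝ}

theorem normalDeriv_solFun (x : G.BVPData) (v : V) [DecidableEq V] :
    G.normalDeriv (G.solFun q hq lam x) v =
      (∑ e with G.t e = v, G.solDeriv q hq lam x e (G.length e)) -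
        ∑ e with G.o e = v, G.solDeriv q hq lam x e 0 := by
  simp only [normalDeriv]
  congr 1
  · refine Finset.sum_congr (by congr) fun e _ =>
      G.edgeDeriv_solFun q hq lam x e (length_mem_interval e)
  · refine Finset.sum_congr (by congr) fun e _ =>
      G.edgeDeriv_solFun q hq lam x e (zero_mem_interval e)

theorem solFun_length {x : G.BVPData} (hx : (G.defect q hq lam α x).1 = 0) (e : E) :
    G.solFun q hq lam x e (G.length e) = x.2.2 (G.t e) := endpointValue_solFun hx (e, true)

theorem solFun_zero {x : G.BVPData} (hx : (G.defect q hq lam α x).1 = 0) (e : E) :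
    G.solFun q hq lam x e 0 = x.2.2 (G.o e) := endpointValue_solFun hx (e, false)

theorem sum_mul_normalDeriv_solFun [Fintype V] (x : G.BVPData) (w : V → ℂ) (σ : ℂ →+* ℂ) :
    ∑ v, w v * σ (G.normalDeriv (G.solFun q hq lam x) v) =
      ∑ e, (w (G.t e) * σ (G.solDeriv q hq lam x e (G.length e)) -
        w (G.o e) * σ (G.solDeriv q hq lam x e 0)) := by
  classical
  simp only [normalDeriv_solFun, map_sub, map_sum, mul_sub, Finset.mul_sum,
    Finset.sum_sub_distrib]
  congr 1
  · rw [← Finset.sum_fiberwise Finset.univ G.t]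
    refine Finset.sum_congr rfl fun v _ => Finset.sum_congr rfl fun e he => ?_
    rw [(Finset.mem_filter.1 he).2]
  · rw [← Finset.sum_fiberwise Finset.univ G.o]
    refine Finset.sum_congr rfl fun v _ => Finset.sum_congr rfl fun e he => ?_
    rw [(Finset.mem_filter.1 he).2]

open ComplexConjugate in
/-- Green's formula on the graph: for solutions that are continuous on the graph, only the
inhomogeneities in the vertex conditions contribute, because `α` is real. -/
theorem green [Fintype V] {x y : G.BVPData} (hx : (G.defect q hq lam α x).1 = 0)
    (hy : (G.defect q hq lam α y).1 = 0) :
    inner ℂ (G.solL2 q hq lam x) y.1 - inner ℂ x.1 (G.solL2 q hq lam y) =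
      ∑ v, (conj ((G.defect q hq lam α x).2 v) * y.2.2 v -
        conj (x.2.2 v) * (G.defect q hq lam α y).2 v) := by
  have hedge : ∀ e, inner ℂ (G.solL2 q hq lam x e) (y.1 e) -
      inner ℂ (x.1 e) (G.solL2 q hq lam y e) =
      (conj (G.solDeriv q hq lam x e (G.length e)) * y.2.2 (G.t e) -
        conj (x.2.2 (G.t e)) * G.solDeriv q hq lam y e (G.length e)) -
      (conj (G.solDeriv q hq lam x e 0) * y.2.2 (G.o e) -
        conj (x.2.2 (G.o e)) * G.solDeriv q hq lam y e 0) := by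
    intro e
    rw [← solFun_length hx, ← solFun_length hy, ← solFun_zero hx, ← solFun_zero hy]
    refine Eq.trans ?_ (green_edge (G.length_pos e).le (shiftedPotential q lam e)
      (G.intervalIntegrable_shiftedPotential hq lam e) (fun t => Complex.conj_ofReal _)
      (x.1 e, x.2.1 e) (y.1 e, y.2.1 e))
    rw [L2.inner_def, L2.inner_def, ← integral_sub (L2.integrable_inner _ _)
      (L2.integrable_inner _ _)]
    refine integral_congr_ae ?_
    filter_upwards [G.coeFn_solL2 q hq lam x e, G.coeFn_solL2 q hq lam y e] with t h1 h2
    rw [RCLike.inner_apply, RCLike.inner_apply, h1, h2, mul_comm,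
      mul_comm (G.solFun q hq lam y e t)]
    rfl
  rw [PiLp.inner_apply, PiLp.inner_apply, ← Finset.sum_sub_distrib,
    Finset.sum_congr rfl fun e _ => hedge e]
  have h1 := sum_mul_normalDeriv_solFun (hq := hq) (lam := lam) x y.2.2 (starRingEnd ℂ)
  have h2 := sum_mul_normalDeriv_solFun (hq := hq) (lam := lam) y (fun v => conj (x.2.2 v))
    (RingHom.id ℂ)
  have h3 : ∀ v, conj ((G.defect q hq lam α x).2 v) * y.2.2 v -
      conj (x.2.2 v) * (G.defect q hq lam α y).2 v =
      y.2.2 v * conj (G.normalDeriv (G.solFun q hq lam x) v) -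
      conj (x.2.2 v) * RingHom.id ℂ (G.normalDeriv (G.solFun q hq lam y) v) := by
    intro v
    change conj (G.normalDeriv (G.solFun q hq lam x) v - (α v : ℂ) * x.2.2 v) * y.2.2 v -
      conj (x.2.2 v) * (G.normalDeriv (G.solFun q hq lam y) v - (α v : ℂ) * y.2.2 v) = _
    rw [map_sub, map_mul, Complex.conj_ofReal, RingHom.id_apply]
    ring
  refine Eq.trans ?_ (Eq.symm ((Finset.sum_congr rfl fun v _ => h3 v).trans
    ((Finset.sum_sub_distrib _ _).trans (congrArg₂ (· - ·) h1 h2))))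
  rw [← Finset.sum_sub_distrib]
  refine Finset.sum_congr rfl fun e _ => ?_
  simp only [RingHom.id_apply]
  ring

theorem isSolution_solFun {x : G.BVPData} {z : ℂ} {h : V → ℂ}
    (hx : G.defect q hq lam α x = (0, h)) (hxz : x.1 = z • G.solL2 q hq lam x) :
    G.IsSolution q α (lam + z) h (G.solFun q hq lam x) := by
  have h1 : (G.defect q hq lam α x).1 = 0 := by rw [hx]
  refine ⟨G.isL2_solFun q hq lam x, G.isAC2_solFun q hq lam x, fun e => ?_,
    isContinuous_solFun h1, fun v => ?_⟩
  · filter_upwards [G.schrodinger_solFun q hq lam x e, G.coeFn_solL2 q hq lam x e,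
      Lp.coeFn_smul z (G.solL2 q hq lam x e)] with t h2 h3 h4
    have h5 : x.1 e t = z * G.solFun q hq lam x e t := by
      rw [← h3, hxz]
      exact h4
    rw [h2, h5]
    simp only [Pi.smul_apply, smul_eq_mul]
    ring
  · rw [normalDeriv_solFun_sub h1, hx]

variable (hq) in
theorem exists_data_of_isSolution {z : ℂ} {h : V → ℂ} {f : E → ℝ → ℂ}
    (hf : G.IsSolution q α (lam + z) h f) :
    ∃ x : G.BVPData, G.defect q hq lam α x = (0, h) ∧ x.1 = z • G.solL2 q hq lam x ∧
      x.2.2 = G.vertexValue f := by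
  obtain ⟨h1, h2, h3, h4, h5⟩ := hf
  let u : G.L2 := WithLp.toLp 2 fun e => (h1 e).toLp
  have hu : ∀ e, u e =ᵐ[volume.restrict (G.interval e)] f e := fun e => (h1 e).coeFn_toLp
  obtain ⟨c, hc1, hc2⟩ := exists_data_of_schrodinger_eq (α := α) hq lam h2 h4 (g := z • u) (by
    intro e
    filter_upwards [h3 e, hu e, Lp.coeFn_smul z (u e)] with t h6 h7 h8
    have h9 : (z • u) e t = z * f e t := by
      rw [← h7]
      exact h8
    rw [h6, h9]
    simp only [Pi.smul_apply, smul_eq_mul]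
    ring)
  refine ⟨(z • u, c, G.vertexValue f), ?_, ?_, rfl⟩
  · rw [hc2]
    exact Prod.ext rfl (funext h5)
  · have : G.solL2 q hq lam (z • u, c, G.vertexValue f) = u := by
      ext1 e
      refine Lp.ext ?_
      filter_upwards [hu e, G.coeFn_solL2 q hq lam (z • u, c, G.vertexValue f) e,
        ae_restrict_mem (measurableSet_Icc (a := (0 : ℝ)) (b := G.length e))] with t h8 h9 hmem
      rw [h8, h9, hc1 e hmem]
    rw [this]

/-- On the resolvent set the solution that defines a column of the Titchmarsh-Weyl matrix is unique
on the graph, so the entries are the vertex values of any data that represent such a solution. The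
spectral parameter is `lam + z` while the data refer to the equation with parameter `lam`, so `z`
times the solution appears as the right-hand side. -/
theorem titchmarshWeyl_apply [DecidableEq V] {x : G.BVPData} {z : ℂ} {B : Finset V} {l : B}
    (hx : G.defect q hq lam α x = (0, Pi.single (l : V) 1))
    (hxz : x.1 = z • G.solL2 q hq lam x)
    (hz : (lam + z : ℂ) ∈ (G.operator q α).resolventSet) (k : B) :
    G.titchmarshWeyl q α B (lam + z) k l = x.2.2 k := by
  have hsol : G.IsSolution q α (lam + z) (Pi.single (l : V) 1) (G.solFun q hq lam x) :=
    isSolution_solFun hx hxz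
  have hsol' := Classical.epsilon_spec (p := G.IsSolution q α (lam + z) (Pi.single (l : V) 1))
    ⟨_, hsol⟩
  obtain ⟨y, hy1, hy2, hy3⟩ := exists_data_of_isSolution hq hsol'
  have hd : G.defect q hq lam α (y - x) = 0 := by
    rw [map_sub, hy1, hx, sub_self]
  have hfst : (y - x).1 = z • G.solL2 q hq lam (y - x) := by
    rw [map_sub, Prod.fst_sub, smul_sub, ← hy2, ← hxz]
  have hmem := solL2_mem_operatorGraph hd
  rw [← operator_graph, LinearPMap.mem_graph_iff] at hmem
  obtain ⟨d, hd1, hd2⟩ := hmem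
  obtain ⟨R, -, hR⟩ := hz
  have hJ : G.solL2 q hq lam (y - x) = 0 := by
    have h1 := hR d
    dsimp only at hd1 hd2
    rw [hd2, hfst, hd1, ← add_smul, sub_self, map_zero] at h1
    exact h1.symm
  have hzero := eq_zero_of_solL2_eq_zero (α := α) (by rw [hfst, hJ, smul_zero]) hJ (by rw [hd]; rfl)
  rw [sub_eq_zero] at hzero
  rw [← hzero, hy3]
  simp only [titchmarshWeyl, Matrix.of_apply]
  congr!

variable (G q hq lam α) in
/-- The solutions of the homogeneous equation that satisfy all vertex conditions, in terms of their
Cauchy data and vertex values. -/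
noncomputable def kernelData : Submodule ℂ ((E → ℂ × ℂ) × (V → ℂ)) :=
  LinearMap.ker (G.defect q hq lam α ∘ₗ LinearMap.inr ℂ G.L2 ((E → ℂ × ℂ) × (V → ℂ)))

theorem mem_kernelData {c : (E → ℂ × ℂ) × (V → ℂ)} :
    c ∈ G.kernelData q hq lam α ↔ G.defect q hq lam α (0, c) = 0 := Iff.rfl

theorem sum_outwardDeriv [DecidableEq V] (v : V) (x : G.BVPData) :
    ∑ p with G.vertexOf p = v, outwardDeriv G q hq lam p x =
      G.normalDeriv (G.solFun q hq lam x) v := by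
  rw [normalDeriv_solFun, Finset.sum_filter, Fintype.sum_prod_type, Finset.sum_filter,
    Finset.sum_filter, ← Finset.sum_sub_distrib]
  refine Finset.sum_congr rfl fun e _ => ?_
  rw [Fintype.sum_bool, outwardDeriv_true, outwardDeriv_false]
  have h1 : G.vertexOf (e, true) = G.t e := rfl
  have h2 : G.vertexOf (e, false) = G.o e := rfl
  rw [h1, h2]
  split_ifs <;> ring

/-- The solutions that satisfy all vertex conditions and vanish on the boundary fulfil the
hypotheses of the combinatorial bound: by uniqueness for the Cauchy problem, zero Cauchy data at one
endpoint of an edge propagate to the other one. -/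
theorem finrank_kernelData_vanishing_le [Fintype V] (hconn : G.IsConnected) (hcyc : 1 ≤ G.cyc)
    (hB : G.boundary.Nonempty) {W : Submodule ℂ ((E → ℂ × ℂ) × (V → ℂ))}
    (hW : W ≤ G.kernelData q hq lam α) (hWB : ∀ c ∈ W, ∀ v ∈ G.boundary, c.2 v = 0) :
    (Module.finrank ℂ W : ℤ) ≤ 2 * G.cyc - 1 := by
  classical
  let ι : W →ₗ[ℂ] G.BVPData := LinearMap.inr ℂ G.L2 ((E → ℂ × ℂ) × (V → ℂ)) ∘ₗ W.subtype
  have hι : ∀ c : W, G.defect q hq lam α (ι c) = 0 := fun c => hW c.2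
  have hι1 : ∀ c : W, (G.defect q hq lam α (ι c)).1 = 0 := fun c => by rw [hι]; rfl
  have hvan : ∀ (c : W) (e : E), c.1.1 e = 0 →
      G.solFun q hq lam (ι c) e = 0 ∧ G.solDeriv q hq lam (ι c) e = 0 := by
    intro c e hc
    have h0 : (((ι c).1 e, (ι c).2.1 e) : Lp ℂ 2 (volume.restrict (Icc 0 (G.length e))) × ℂ × ℂ)
        = 0 := Prod.ext rfl hc
    constructor
    · funext t
      change solVal _ _ _ ((ι c).1 e, (ι c).2.1 e) t = 0
      rw [h0, solVal, map_zero]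
      rfl
    · funext t
      change solDer _ _ _ ((ι c).1 e, (ι c).2.1 e) t = 0
      rw [h0, solDer, map_zero]
      rfl
  refine G.finrank_le_of_vanish_on_boundary hconn hcyc hB
    (fun v => LinearMap.proj v ∘ₗ LinearMap.snd ℂ _ _ ∘ₗ W.subtype)
    (fun p => outwardDeriv G q hq lam p ∘ₗ ι) ?_ ?_ ?_ ?_
  · rintro ⟨e, b⟩ c h1 h2
    have hval : ∀ b, c.1.2 (G.vertexOf (e, b)) =
        G.endpointValue (G.solFun q hq lam (ι c)) (e, b) := fun b =>
      (endpointValue_solFun (hι1 c) (e, b)).symm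
    have hc : c.1.1 e = 0 := by
      cases b with
      | false =>
        refine Prod.ext ?_ ?_
        · exact (solVal_zero _ _ _ ((ι c).1 e, (ι c).2.1 e)).symm.trans ((hval false).symm.trans h1)
        · exact (solDer_zero _ _ _ ((ι c).1 e, (ι c).2.1 e)).symm.trans (neg_eq_zero.1 h2)
      | true =>
        have h3 := eq_zero_of_solVal_solDer_right (a := (c.1.1 e).1) (b := (c.1.1 e).2)
          (G.length_pos e).le (shiftedPotential q lam e)
          (G.intervalIntegrable_shiftedPotential hq lam e) (fun t => Complex.conj_ofReal _)
          ((hval true).symm.trans h1) h2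
        exact Prod.ext h3.1 h3.2
    obtain ⟨h3, h4⟩ := hvan c e hc
    constructor
    · change c.1.2 (G.vertexOf (e, !b)) = 0
      rw [hval, endpointValue, h3]
      rfl
    · change outwardDeriv G q hq lam (e, !b) (ι c) = 0
      cases b
      · rw [Bool.not_false, outwardDeriv_true, h4]
        rfl
      · rw [Bool.not_true, outwardDeriv_false, h4]
        simp
  · intro v c hv
    have h1 := congrFun (congrArg Prod.snd (hι c)) v
    change G.normalDeriv (G.solFun q hq lam (ι c)) v - (α v : ℂ) * c.1.2 v = 0 at h1
    have h2 : c.1.2 v = 0 := hv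
    rw [h2, mul_zero, sub_zero] at h1
    rw [← h1, ← sum_outwardDeriv]
    congr!
  · exact fun v hv c => hWB c c.2 v hv
  · intro c h1 h2
    refine Subtype.ext (Prod.ext (funext fun e => Prod.ext ?_ ?_) (funext h1))
    · have h3 : G.solFun q hq lam (ι c) e 0 = 0 :=
        (endpointValue_solFun (hι1 c) (e, false)).trans (h1 _)
      exact (solVal_zero (G.length_pos e).le _ (G.intervalIntegrable_shiftedPotential hq lam e)
        ((ι c).1 e, (ι c).2.1 e)).symm.trans h3
    · have h3 : G.solDeriv q hq lam (ι c) e 0 = 0 := neg_eq_zero.1 (h2 (e, false))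
      exact (solDer_zero (G.length_pos e).le _ (G.intervalIntegrable_shiftedPotential hq lam e)
        ((ι c).1 e, (ι c).2.1 e)).symm.trans h3

end MetricGraph

/-! ### Symmetry and the Fredholm alternative -/

namespace MetricGraph

variable {V E : Type*} {G : MetricGraph V E} {q : E → ℝ → ℝ}
  {hq : ∀ e, IntegrableOn (q e) (Icc 0 (G.length e))} {lam : ℝ} [Fintype E] {α : V → ℝ}

variable (hq) in
theorem exists_data_of_mem_domain (lam : ℝ) (u : (G.operator q α).domain) :
    ∃ x : G.BVPData, x.1 = G.operator q α u - (lam : ℂ) • (u : G.L2) ∧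
      G.solL2 q hq lam x = u ∧ G.defect q hq lam α x = 0 := by
  have h := (G.operator q α).mem_graph u
  rw [operator_graph] at h
  obtain ⟨c, h1, h2⟩ := exists_data_of_mem_operatorGraph hq lam h
  exact ⟨_, rfl, h1, h2⟩

theorem exists_mem_domain_of_defect_eq_zero {x : G.BVPData} (hx : G.defect q hq lam α x = 0) :
    ∃ u : (G.operator q α).domain, (u : G.L2) = G.solL2 q hq lam x ∧
      G.operator q α u - (lam : ℂ) • (u : G.L2) = x.1 := by
  have hmem := solL2_mem_operatorGraph hx
  rw [← operator_graph, LinearPMap.mem_graph_iff] at hmem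
  obtain ⟨u, h1, h2⟩ := hmem
  dsimp only at h1 h2
  exact ⟨u, h1, by rw [h2, h1, add_sub_cancel_left]⟩

theorem operator_symmetric [Fintype V]
    (hq : ∀ e, IntegrableOn (q e) (Icc 0 (G.length e)))
    (u w : (G.operator q α).domain) :
    inner ℂ (G.operator q α u) (w : G.L2) = inner ℂ (u : G.L2) (G.operator q α w) := by
  obtain ⟨x, hx1, hx2, hx3⟩ := exists_data_of_mem_domain hq 0 u
  obtain ⟨y, hy1, hy2, hy3⟩ := exists_data_of_mem_domain hq 0 w
  have h := green (α := α) (x := x) (y := y) (by rw [hx3]; rfl) (by rw [hy3]; rfl)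
  rw [hx1, hx2, hx3, hy1, hy2, hy3] at h
  simp only [Complex.ofReal_zero, zero_smul, sub_zero, Prod.snd_zero, Pi.zero_apply, map_zero,
    zero_mul, mul_zero, Finset.sum_const_zero] at h
  exact (sub_eq_zero.1 h).symm

variable (hq lam α) in
/-- The eigenvectors of `A_α` are parametrized by the Cauchy data and vertex values. -/
noncomputable def kernelEquiv :
    G.kernelData q hq lam α ≃ₗ[ℂ] (G.operator q α).eigenvectors (lam : ℂ) :=
  LinearEquiv.ofBijective
    (LinearMap.codRestrict ((G.operator q α).eigenvectors (lam : ℂ))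
      (G.solL2 q hq lam ∘ₗ LinearMap.inr ℂ G.L2 ((E → ℂ × ℂ) × (V → ℂ)) ∘ₗ
        (G.kernelData q hq lam α).subtype)
      fun c => by
        obtain ⟨u, hu1, hu2⟩ := exists_mem_domain_of_defect_eq_zero (mem_kernelData.1 c.2)
        exact LinearPMap.mem_eigenvectors.2 ⟨u, sub_eq_zero.1 hu2, hu1⟩)
    (by
      constructor
      · rw [injective_iff_map_eq_zero]
        intro c hc
        have h := eq_zero_of_solL2_eq_zero (α := α) (x := ((0 : G.L2), (c : (E → ℂ × ℂ) × (V → ℂ))))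
          rfl (congrArg Subtype.val hc) (by rw [mem_kernelData.1 c.2]; rfl)
        exact Subtype.ext (congrArg Prod.snd h)
      · rintro ⟨n, hn⟩
        obtain ⟨u, hu, rfl⟩ := LinearPMap.mem_eigenvectors.1 hn
        obtain ⟨x, hx1, hx2, hx3⟩ := exists_data_of_mem_domain hq lam u
        have hx : x = (0, x.2) := Prod.ext (by rw [hx1, hu, sub_self]) rfl
        rw [hx] at hx2 hx3
        exact ⟨⟨x.2, mem_kernelData.2 hx3⟩, Subtype.ext hx2⟩)

theorem coe_kernelEquiv (c : G.kernelData q hq lam α) :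
    (kernelEquiv hq lam α c : G.L2) = G.solL2 q hq lam (0, c) := rfl

theorem finiteDimensional_eigenvectors [Fintype V]
    (hq : ∀ e, IntegrableOn (q e) (Icc 0 (G.length e))) :
    FiniteDimensional ℂ ((G.operator q α).eigenvectors (lam : ℂ)) :=
  (kernelEquiv hq lam α).finiteDimensional

theorem mem_orthogonal_of_defect_eq_zero [Fintype V] {x : G.BVPData}
    (hx : G.defect q hq lam α x = 0) : x.1 ∈ ((G.operator q α).eigenvectors (lam : ℂ))ᗮ := by
  obtain ⟨u, -, hu⟩ := exists_mem_domain_of_defect_eq_zero hx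
  rw [← hu]
  exact LinearPMap.sub_mem_orthogonal (operator_symmetric hq) u

variable (hq) in
/-- Every boundary value problem is solvable with a right-hand side from the eigenspace: the map
`(n, c) ↦ defect (n, c)` on `ker (A_α - lam) × ℂ^(2 r + s)` has a kernel of dimension
`dim ker (A_α - lam)`, since a right-hand side that is solvable without defect is orthogonal to the
eigenspace. -/
theorem exists_defect_eq [Fintype V] (ξ : (E × Bool → ℂ) × (V → ℂ)) :
    ∃ n ∈ (G.operator q α).eigenvectors (lam : ℂ), ∃ c, G.defect q hq lam α (n, c) = ξ := by
  have := finiteDimensional_eigenvectors (G := G) (α := α) (lam := lam) hq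
  set N := (G.operator q α).eigenvectors (lam : ℂ) with hN
  let Ψ : N × ((E → ℂ × ℂ) × (V → ℂ)) →ₗ[ℂ] (E × Bool → ℂ) × (V → ℂ) :=
    G.defect q hq lam α ∘ₗ N.subtype.prodMap LinearMap.id
  have hker : ∀ y ∈ LinearMap.ker Ψ, y.1 = 0 := by
    intro y hy
    have h := mem_orthogonal_of_defect_eq_zero (show G.defect q hq lam α ((y.1 : G.L2), y.2) = 0
      from hy)
    exact Subtype.ext (N.disjoint_def.1 N.orthogonal_disjoint _ y.1.2 h)
  have hle : Module.finrank ℂ (LinearMap.ker Ψ) ≤ Module.finrank ℂ N := by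
    rw [← (kernelEquiv hq lam α).finrank_eq]
    let j : LinearMap.ker Ψ →ₗ[ℂ] G.kernelData q hq lam α :=
      LinearMap.codRestrict _ (LinearMap.snd ℂ _ _ ∘ₗ (LinearMap.ker Ψ).subtype) fun y => by
        have h1 : G.defect q hq lam α ((y.1.1 : G.L2), y.1.2) = 0 := y.2
        rw [hker y y.2] at h1
        exact h1
    refine LinearMap.finrank_le_finrank_of_injective (f := j) ?_
    intro y y' h
    refine Subtype.ext (Prod.ext ?_ (congrArg Subtype.val h))
    rw [hker y y.2, hker y' y'.2]
  have hrn := LinearMap.finrank_range_add_finrank_ker Ψ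
  have hdim : Module.finrank ℂ ((E → ℂ × ℂ) × (V → ℂ)) =
      Module.finrank ℂ ((E × Bool → ℂ) × (V → ℂ)) := by
    rw [Module.finrank_prod, Module.finrank_prod, Module.finrank_pi_fintype,
      Module.finrank_fintype_fun_eq_card]
    simp
  rw [Module.finrank_prod, hdim] at hrn
  have hsurj : LinearMap.range Ψ = ⊤ :=
    Submodule.eq_top_of_finrank_eq (le_antisymm (Submodule.finrank_le _) (by omega))
  obtain ⟨y, hy⟩ := LinearMap.range_eq_top.1 hsurj ξ
  exact ⟨y.1, y.1.2, y.2, hy⟩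

/-- The Fredholm alternative: `A_α - lam` maps onto the orthogonal complement of its kernel. -/
theorem exists_operator_sub_eq [Fintype V]
    (hq : ∀ e, IntegrableOn (q e) (Icc 0 (G.length e)))
    {g : G.L2}
    (hg : g ∈ ((G.operator q α).eigenvectors (lam : ℂ))ᗮ) :
    ∃ u : (G.operator q α).domain, G.operator q α u - (lam : ℂ) • (u : G.L2) = g := by
  set N := (G.operator q α).eigenvectors (lam : ℂ) with hN
  obtain ⟨n, hn, c, hc⟩ := exists_defect_eq (α := α) (lam := lam) hq
    (G.defect q hq lam α (g, 0))
  have h0 : G.defect q hq lam α (g - n, 0 - c) = 0 := by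
    rw [← Prod.mk_sub_mk, map_sub, hc, sub_self]
  obtain ⟨u, -, hu⟩ := exists_mem_domain_of_defect_eq_zero h0
  have h1 : g - n ∈ Nᗮ := mem_orthogonal_of_defect_eq_zero (x := (g - n, 0 - c)) h0
  have h2 : n ∈ Nᗮ := by
    have h := Nᗮ.sub_mem hg h1
    rwa [sub_sub_cancel] at h
  have h3 : n = 0 := N.disjoint_def.1 N.orthogonal_disjoint _ hn h2
  exact ⟨u, by rw [hu, h3, sub_zero]⟩

end MetricGraph

/-! ### Matrix functions with a simple pole -/

section Laurent

variable {n : Type*} {Ω : Set ℂ} {M : ℂ → Matrix n n ℂ} {T : Matrix n n ℂ} {H : ℂ → Matrix n n ℂ}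
  {c : ℂ} {ε : ℝ}

/-- `M` is defined in a punctured neighbourhood of `c`, where it differs from `T / (w - c)` by a
matrix function that is analytic at `c`. -/
structure HasSimplePart (Ω : Set ℂ) (M : ℂ → Matrix n n ℂ) (c : ℂ) (T : Matrix n n ℂ)
    (H : ℂ → Matrix n n ℂ) (ε : ℝ) : Prop where
  pos : 0 < ε
  subset : Metric.ball c ε \ {c} ⊆ Ω
  eq : ∀ w ∈ Metric.ball c ε \ {c}, ∀ i j, M w i j = (w - c)⁻¹ * T i j + H w i j
  differentiableOn : ∀ i j, DifferentiableOn ℂ (fun w => H w i j) (Metric.ball c ε)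

theorem HasSimplePart.analyticAround (h : HasSimplePart Ω M c T H ε) : AnalyticAround Ω M c := by
  refine ⟨Metric.ball c ε, Metric.isOpen_ball, Metric.mem_ball_self h.pos, h.subset, fun i j => ?_⟩
  refine DifferentiableOn.congr (f := fun w => (w - c)⁻¹ * T i j + H w i j) ?_
    fun w hw => h.eq w hw i j
  refine DifferentiableOn.add (DifferentiableOn.mul_const ?_ _)
    ((h.differentiableOn i j).mono sdiff_subset)
  exact DifferentiableOn.fun_inv (differentiableOn_id.sub_const c) fun w hw => sub_ne_zero.2 hw.2

theorem HasSimplePart.hasResidue (h : HasSimplePart Ω M c T H ε) : HasResidue Ω M c T := by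
  refine ⟨h.analyticAround, ?_⟩
  filter_upwards [Ioo_mem_nhdsGT h.pos] with r hr i j
  have hsub : Metric.closedBall c r ⊆ Metric.ball c ε := Metric.closedBall_subset_ball hr.2
  have hsph : ∀ w ∈ Metric.sphere c r, w ∈ Metric.ball c ε \ {c} := fun w hw =>
    ⟨hsub (Metric.sphere_subset_closedBall hw), Metric.ne_of_mem_sphere hw hr.1.ne'⟩
  have hH : DifferentiableOn ℂ (fun w => H w i j) (Metric.closedBall c r) :=
    (h.differentiableOn i j).mono hsub
  have h1 : (∮ w in C(c, r), H w i j) = 0 :=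
    (DifferentiableOn.diffContOnCl (by
      rwa [closure_ball c hr.1.ne'])).circleIntegral_eq_zero hr.1.le
  have hci : CircleIntegrable (fun w => (w - c)⁻¹ * T i j) c r := by
    refine ContinuousOn.circleIntegrable hr.1.le (ContinuousOn.mul ?_ continuousOn_const)
    exact ContinuousOn.inv₀ (continuousOn_id.sub continuousOn_const)
      fun w hw => sub_ne_zero.2 (hsph w hw).2
  have hcH : CircleIntegrable (fun w => H w i j) c r :=
    (hH.continuousOn.mono Metric.sphere_subset_closedBall).circleIntegrable hr.1.le
  rw [circleIntegral.integral_congr hr.1.le fun w hw => h.eq w (hsph w hw) i j,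
    circleIntegral.integral_add hci hcH, h1, add_zero]
  have h2 : (∮ w in C(c, r), (w - c)⁻¹ * T i j) = 2 * Real.pi * Complex.I * T i j := by
    have h3 := circleIntegral.integral_smul_const (fun w => (w - c)⁻¹) (T i j) c r
    simp only [smul_eq_mul] at h3
    rw [h3, circleIntegral.integral_sub_center_inv c hr.1.ne']
  rw [h2, ← mul_assoc, inv_mul_cancel₀ Complex.two_pi_I_ne_zero, one_mul]

theorem HasSimplePart.tendsto (h : HasSimplePart Ω M c T H ε) (k : ℕ) :
    Tendsto (fun w => (w - c) ^ (k + 1) • M w) (𝓝[≠] c) (𝓝 ((0 : ℂ) ^ k • T)) := by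
  refine tendsto_pi_nhds.2 fun i => tendsto_pi_nhds.2 fun j => ?_
  have hball : Metric.ball c ε ∈ 𝓝 c := Metric.ball_mem_nhds c h.pos
  have hHc : ContinuousAt (fun w => H w i j) c :=
    ((h.differentiableOn i j).differentiableAt hball).continuousAt
  have hlim : Tendsto (fun w => (w - c) ^ k * T i j + (w - c) ^ (k + 1) * H w i j) (𝓝 c)
      (𝓝 ((0 : ℂ) ^ k • T i j)) := by
    have hsub : ContinuousAt (fun w : ℂ => w - c) c := by fun_prop
    have hcont : ContinuousAt (fun w => (w - c) ^ k * T i j + (w - c) ^ (k + 1) * H w i j) c :=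
      ((hsub.pow k).mul continuousAt_const).add ((hsub.pow (k + 1)).mul hHc)
    have := hcont.tendsto
    simpa using this
  refine (hlim.mono_left nhdsWithin_le_nhds).congr' ?_
  filter_upwards [self_mem_nhdsWithin, mem_nhdsWithin_of_mem_nhds hball] with w hw hwb
  have hne : w - c ≠ 0 := sub_ne_zero.2 hw
  rw [Matrix.smul_apply, h.eq w ⟨hwb, hw⟩ i j, smul_eq_mul, pow_succ]
  field_simp

theorem HasSimplePart.isPole_iff (h : HasSimplePart Ω M c T H ε) : IsPole Ω M c ↔ T ≠ 0 := by
  constructor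
  · rintro ⟨k, hk, -, ⟨S, hS, hlim⟩, -⟩ rfl
    obtain ⟨j, rfl⟩ := Nat.exists_eq_add_of_le' hk
    refine hS (tendsto_nhds_unique hlim ?_)
    simpa using h.tendsto j
  · intro hT
    refine ⟨1, le_rfl, h.analyticAround, ⟨T, hT, ?_⟩, ?_⟩
    · simpa using h.tendsto 0
    · simpa using h.tendsto 1

end Laurent

/-- The regular part of the Titchmarsh-Weyl matrix at `lam`, as a function of `z = μ - lam`, is
built from the inverse of `1 - z • K` and bounded operators, so it is analytic where this inverse
exists. -/
theorem differentiableAt_laurent_remainder {X : Type*} [NormedAddCommGroup X]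
    [InnerProductSpace ℂ X] [CompleteSpace X] (K P : X →L[ℂ] X) {z : ℂ} (hz : IsUnit (1 - z • K))
    (a b g h : X) (c d : ℂ) :
    DifferentiableAt ℂ (fun z : ℂ => c - inner ℂ a ((g - z • h) +
      (z • K (Ring.inverse (1 - z • K) (g - z • h)) - P (g - z • h))) +
      (inner ℂ b (K (Ring.inverse (1 - z • K) (g - z • h))) + d)) z := by
  have hlin : DifferentiableAt ℂ (fun z : ℂ => 1 - z • K) z := by fun_prop
  have hS : DifferentiableAt ℂ (fun z : ℂ => Ring.inverse (1 - z • K)) z :=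
    DifferentiableAt.comp (g := Ring.inverse (M₀ := X →L[ℂ] X)) z
      (differentiableAt_inverse hz) hlin
  have hy : DifferentiableAt ℂ (fun z : ℂ => g - z • h) z := by fun_prop
  have hSg : DifferentiableAt ℂ (fun z : ℂ => Ring.inverse (1 - z • K) (g - z • h)) z :=
    hS.clm_apply hy
  have hSy : DifferentiableAt ℂ (fun z : ℂ => K (Ring.inverse (1 - z • K) (g - z • h))) z :=
    (differentiableAt_const K).clm_apply hSg
  have hPy : DifferentiableAt ℂ (fun z : ℂ => P (g - z • h)) z :=
    (differentiableAt_const P).clm_apply hy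
  have hinner : ∀ (a : X) {f : ℂ → X}, DifferentiableAt ℂ f z →
      DifferentiableAt ℂ (fun z => inner ℂ a (f z)) z := fun a f hf =>
    (differentiableAt_const (innerSL ℂ a)).clm_apply hf
  have hzS : DifferentiableAt ℂ
      (fun z : ℂ => z • K (Ring.inverse (1 - z • K) (g - z • h))) z :=
    differentiableAt_id.fun_smul hSy
  have h1 := (hinner a (hy.fun_add (hzS.fun_sub hPy))).const_sub c
  have h2 := (hinner b hSy).add_const d
  exact h1.fun_add h2

/-! ### The rank of a Gram matrix -/

open scoped ComplexOrder in
/-- The rank of the negative of a Gram matrix is the codimension of the orthogonal complement of the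
vectors, which is the kernel of `ev`. -/
theorem rank_neg_gram_add_finrank {B N : Type*} [Fintype B] [NormedAddCommGroup N]
    [InnerProductSpace ℂ N] [FiniteDimensional ℂ N] (p : B → N) (ev : N →ₗ[ℂ] (B → ℂ))
    (hev : ∀ n k, ev n k = inner ℂ (p k) n) :
    (Matrix.of fun k l => -inner ℂ (p k) (p l) : Matrix B B ℂ).rank +
      Module.finrank ℂ (LinearMap.ker ev) = Module.finrank ℂ N := by
  classical
  set b := stdOrthonormalBasis ℂ N
  set Q : Matrix B (Fin (Module.finrank ℂ N)) ℂ :=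
    LinearMap.toMatrix b.toBasis (Pi.basisFun ℂ B) ev with hQ
  have hQapp : ∀ k j, Q k j = inner ℂ (p k) (b j) := fun k j => by
    rw [hQ, LinearMap.toMatrix_apply, Pi.basisFun_repr, hev, OrthonormalBasis.coe_toBasis]
  have h1 : (Matrix.of fun k l => -inner ℂ (p k) (p l) : Matrix B B ℂ) =
      (-Q) * Q.conjTranspose := by
    ext k l
    rw [Matrix.neg_mul, Matrix.neg_apply, Matrix.mul_apply, Matrix.of_apply,
      ← b.sum_inner_mul_inner]
    congr 1
    refine Finset.sum_congr rfl fun j _ => ?_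
    rw [Matrix.conjTranspose_apply, hQapp, hQapp, ← starRingEnd_apply, inner_conj_symm]
  have h2 : ((-Q) * Q.conjTranspose).rank = Q.rank := by
    rw [← Matrix.rank_self_mul_conjTranspose Q]
    have : (-Q) * Q.conjTranspose = (-1 : ℂ) • (Q * Q.conjTranspose) := by
      rw [Matrix.neg_mul, neg_one_smul]
    rw [this]
    exact Matrix.rank_smul_of_mem_nonZeroDivisors _ (by simp)
  rw [h1, h2, Matrix.rank_eq_finrank_range_toLin Q (Pi.basisFun ℂ B) b.toBasis, hQ,
    Matrix.toLin_toMatrix]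
  exact LinearMap.finrank_range_add_finrank_ker ev

/-! ### The Laurent expansion of the Titchmarsh-Weyl matrix -/

namespace MetricGraph

variable {V E : Type*} {G : MetricGraph V E} {q : E → ℝ → ℝ}
  {hq : ∀ e, IntegrableOn (q e) (Icc 0 (G.length e))} {lam : ℝ} [Fintype E] {α : V → ℝ}

/-- The value at `k` of a solution without defect, from Green's formula for it and a solution with
unit inhomogeneity at `k`. -/
theorem green_single [Fintype V] [DecidableEq V] {x y : G.BVPData} {k : V}
    (hx : G.defect q hq lam α x = (0, Pi.single k 1)) (hy : G.defect q hq lam α y = 0) :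
    y.2.2 k = inner ℂ (G.solL2 q hq lam x) y.1 - inner ℂ x.1 (G.solL2 q hq lam y) := by
  rw [green (α := α) (by rw [hx]) (by rw [hy]; rfl), hx, hy, Finset.sum_eq_single k]
  · simp
  · intro v _ hv
    simp [Pi.single_eq_of_ne hv]
  · intro h
    exact absurd (Finset.mem_univ k) h

variable (G q hq lam α) in
/-- The Laurent expansion of the Titchmarsh-Weyl matrix at `lam`: the `l`-th column consists of the
vertex values of `x l - Y`, where `Y` is the problem without defect for which `x l - Y` represents a
solution with parameter `lam + z`. The values of `Y` are inner products with the
resolvent, and its simple pole produces the singular part. -/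
theorem exists_hasSimplePart_titchmarshWeyl [Fintype V] [DecidableEq V] (B : Finset V)
    [FiniteDimensional ℂ ((G.operator q α).eigenvectors (lam : ℂ))]
    (x : V → G.BVPData) (hx : ∀ v, G.defect q hq lam α (x v) = (0, Pi.single v 1)) :
    ∃ H ε, HasSimplePart (G.operator q α).resolventSet (G.titchmarshWeyl q α B) (lam : ℂ)
      (Matrix.of fun k l : B => -inner ℂ (x k).1
        (((G.operator q α).eigenvectors (lam : ℂ)).starProjection (x l).1)) H ε := by
  set A := G.operator q α with hA
  set P := (A.eigenvectors (lam : ℂ)).starProjection with hP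
  obtain ⟨K, hK⟩ := LinearPMap.exists_isPseudoInverse (A := A) (lam := lam)
    (operator_symmetric hq) fun g hg => exists_operator_sub_eq hq hg
  -- If `h v` solves `L h = lam h + g` with inhomogeneity at `v`, then `h v - u` solves the equation
  -- with parameter `lam + z` and the same inhomogeneity, where `u` is the resolvent at `lam + z`
  -- applied to `y v z = g - z • h v`.
  set h : V → G.L2 := fun v => G.solL2 q hq lam (x v) with hh
  let y : V → ℂ → G.L2 := fun v z => (x v).1 - z • h v
  let S : ℂ → G.L2 →L[ℂ] G.L2 := fun z => Ring.inverse (1 - z • K)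
  let H₀ : ℂ → Matrix B B ℂ := fun z => Matrix.of fun k l =>
    (x l).2.2 k - inner ℂ (h k) (y l z + (z • K (S z (y l z)) - P (y l z))) +
      (inner ℂ (x k).1 (K (S z (y l z))) + inner ℂ (x k).1 (P (h l)))
  have hopen : ∀ᶠ z : ℂ in 𝓝 0, IsUnit (1 - z • K) := by
    have hc : ContinuousAt (fun z : ℂ => 1 - z • K) 0 := by fun_prop
    have h0 : IsUnit (1 - (0 : ℂ) • K) := by simp
    exact hc.preimage_mem_nhds (Units.isOpen.mem_nhds h0)
  obtain ⟨ε, hε, hball⟩ := Metric.eventually_nhds_iff_ball.1 hopen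
  have hdist : ∀ w ∈ Metric.ball (lam : ℂ) ε, w - lam ∈ Metric.ball (0 : ℂ) ε := by
    intro w hw
    rwa [Metric.mem_ball, dist_zero_right, ← dist_eq_norm]
  have hres : ∀ z ∈ Metric.ball (0 : ℂ) ε, z ≠ 0 → (lam : ℂ) + z ∈ A.resolventSet := by
    intro z hz hz0
    refine LinearPMap.add_mem_resolventSet hK (fun u => ?_) hz0 (hball z hz)
    exact (A.eigenvectors (lam : ℂ)).starProjection_apply_eq_zero_iff.2
      (LinearPMap.sub_mem_orthogonal (operator_symmetric hq) u)
  have hM : ∀ z ∈ Metric.ball (0 : ℂ) ε, z ≠ 0 → ∀ k l : B,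
      G.titchmarshWeyl q α B (lam + z) k l = z⁻¹ * (-inner ℂ (x k).1 (P (x l).1)) + H₀ z k l := by
    intro z hz hz0 k l
    obtain ⟨u, hu1, hu2⟩ := LinearPMap.localResolvent_spec hK hz0 (hball z hz) (y l z)
    have hu1' : (u : G.L2) = K (S z (y l z)) - z⁻¹ • P (y l z) := hu1
    obtain ⟨Y, hY1, hY2, hY3⟩ := exists_data_of_mem_domain hq lam u
    have hY1' : Y.1 = y l z + z • (u : G.L2) := by
      rw [hY1, ← hu2, add_smul]
      abel
    have hw := titchmarshWeyl_apply (B := B) (l := l) (x := x l - Y) (z := z)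
      (by rw [map_sub, hx, hY3, sub_zero])
      (by
        rw [map_sub, hY2, Prod.fst_sub, hY1', smul_sub]
        change (x l).1 - ((x l).1 - z • h l + z • (u : G.L2)) = z • h l - z • (u : G.L2)
        abel)
      (hres z hz hz0) k
    have hzu : z • (u : G.L2) = z • K (S z (y l z)) - P (y l z) := by
      rw [hu1', smul_sub, smul_smul, mul_inv_cancel₀ hz0, one_smul]
    have hPy : P (y l z) = P (x l).1 - z • P (h l) := by
      rw [map_sub, map_smul]
    rw [hw]
    change (x l).2.2 k - Y.2.2 k = _
    rw [green_single (hx k) hY3, hY1', hY2, hzu]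
    have hin : inner ℂ (x k).1 (u : G.L2) = inner ℂ (x k).1 (K (S z (y l z))) -
        z⁻¹ * inner ℂ (x k).1 (P (x l).1) + inner ℂ (x k).1 (P (h l)) := by
      rw [hu1', inner_sub_right, inner_smul_right, hPy, inner_sub_right, inner_smul_right, mul_sub,
        ← mul_assoc, inv_mul_cancel₀ hz0, one_mul]
      ring
    rw [hin]
    simp only [H₀, Matrix.of_apply]
    ring
  refine ⟨fun w => H₀ (w - lam), ε, hε, ?_, ?_, ?_⟩
  · rintro w ⟨hw, hne⟩
    have := hres (w - lam) (hdist w hw) (sub_ne_zero.2 hne)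
    rwa [add_sub_cancel] at this
  · rintro w ⟨hw, hne⟩ k l
    have := hM (w - lam) (hdist w hw) (sub_ne_zero.2 hne) k l
    rwa [add_sub_cancel] at this
  · intro k l
    have hdiff : DifferentiableOn ℂ (fun z => H₀ z k l) (Metric.ball 0 ε) := by
      intro z hz
      refine DifferentiableAt.differentiableWithinAt ?_
      exact differentiableAt_laurent_remainder K P (hball z hz) _ _ _ _ _ _
    exact hdiff.comp ((differentiableOn_id).sub_const (lam : ℂ)) fun w hw => hdist w hw

end MetricGraph

/-! ### The residue and the multiplicity -/

namespace MetricGraph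

variable {V E : Type*} {G : MetricGraph V E} {q : E → ℝ → ℝ} [Fintype V] [Fintype E]

/-- The singular part of the Titchmarsh-Weyl matrix at `lam` is a simple pole, and the rank of its
coefficient is the codimension of the eigenfunctions that vanish on the boundary. -/
theorem exists_simplePart_rank_bounds (hconn : G.IsConnected) (hcyc : 1 ≤ G.cyc)
    (hB : G.boundary.Nonempty) (hq : ∀ e, IntegrableOn (q e) (Icc 0 (G.length e))) (α : V → ℝ)
    (lam : ℝ) :
    ∃ T H ε, HasSimplePart (G.operator q α).resolventSet (G.titchmarshWeyl q α G.boundary)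
        (lam : ℂ) T H ε ∧
      T.rank ≤ Module.finrank ℂ ((G.operator q α).eigenvectors (lam : ℂ)) ∧
      (Module.finrank ℂ ((G.operator q α).eigenvectors (lam : ℂ)) : ℤ) ≤
        T.rank + 2 * G.cyc - 1 := by
  classical
  have : FiniteDimensional ℂ ((G.operator q α).eigenvectors (lam : ℂ)) :=
    finiteDimensional_eigenvectors hq
  set N := (G.operator q α).eigenvectors (lam : ℂ)
  have hex : ∀ v : V, ∃ x : G.BVPData, x.1 ∈ N ∧
      G.defect q hq lam α x = (0, Pi.single v 1) := fun v => by
    obtain ⟨n, hn, c, hc⟩ := exists_defect_eq hq (lam := lam) (α := α) (0, Pi.single v (1 : ℂ))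
    exact ⟨(n, c), hn, hc⟩
  choose x hxN hx using hex
  obtain ⟨H, ε, hS⟩ := exists_hasSimplePart_titchmarshWeyl G q hq lam α G.boundary x hx
  let p : G.boundary → N := fun k => ⟨(x k).1, hxN k⟩
  have hT : (Matrix.of fun k l : G.boundary => -inner ℂ (x k).1 (N.starProjection (x l).1)) =
      (Matrix.of fun k l => -inner ℂ (p k) (p l) : Matrix G.boundary G.boundary ℂ) := by
    ext k l
    rw [Matrix.of_apply, Matrix.of_apply, N.starProjection_eq_self_iff.2 (hxN l),
      Submodule.coe_inner]
  replace hS := hT ▸ hS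
  let ev : N →ₗ[ℂ] (G.boundary → ℂ) := LinearMap.pi fun k => (innerSL ℂ (p k)).toLinearMap
  have hrank := rank_neg_gram_add_finrank p ev fun n k => rfl
  -- By Green's identity `ev` gives, up to sign, the values of an eigenfunction on the boundary.
  let j : N →ₗ[ℂ] (E → ℂ × ℂ) × (V → ℂ) :=
    (G.kernelData q hq lam α).subtype ∘ₗ (kernelEquiv hq lam α).symm.toLinearMap
  have hj : Function.Injective j :=
    (G.kernelData q hq lam α).injective_subtype.comp (kernelEquiv hq lam α).symm.injective
  have hval : ∀ (n : N) (k : G.boundary), (j n).2 k = -ev n k := fun n k => by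
    have h1 : G.solL2 q hq lam (0, j n) = n := by
      have := coe_kernelEquiv (hq := hq) (lam := lam) (α := α) ((kernelEquiv hq lam α).symm n)
      rw [LinearEquiv.apply_symm_apply] at this
      exact this.symm
    have h2 := green_single (y := (0, j n)) (hx k)
      (mem_kernelData.1 ((kernelEquiv hq lam α).symm n).2)
    rw [inner_zero_right, zero_sub, h1] at h2
    exact h2
  have hker := finrank_kernelData_vanishing_le hconn hcyc hB
    (W := (LinearMap.ker ev).map j) (q := q) (hq := hq) (lam := lam) (α := α)
    (by
      rintro _ ⟨n, -, rfl⟩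
      exact ((kernelEquiv hq lam α).symm n).2)
    (by
      rintro _ ⟨n, hn, rfl⟩ v hv
      have := hval n ⟨v, hv⟩
      rw [LinearMap.mem_ker.1 hn] at this
      simpa using this)
  rw [← (Submodule.equivMapOfInjective j hj (LinearMap.ker ev)).finrank_eq] at hker
  exact ⟨_, H, ε, hS, by omega, by omega⟩

end MetricGraph

theorem mainTheorem5 {V E : Type*} [Fintype V] [Fintype E] (G : MetricGraph V E)
    (hconn : G.IsConnected) (hcyc : 1 ≤ G.cyc) (hB : G.boundary.Nonempty)
    (q : E → ℝ → ℝ) (hq : ∀ e, IntegrableOn (q e) (Icc 0 (G.length e)))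
    (α : V → ℝ) (lam : ℝ) :
    (IsPole (G.operator q α).resolventSet (G.titchmarshWeyl q α G.boundary) (lam : ℂ) →
      (G.operator q α).eigenspace (lam : ℂ) ≠ ⊥) ∧
    FiniteDimensional ℂ ((G.operator q α).eigenspace (lam : ℂ)) ∧
    ((G.operator q α).eigenspace (lam : ℂ) ≠ ⊥ →
      2 * G.cyc - 1 < (Module.finrank ℂ ((G.operator q α).eigenspace (lam : ℂ)) : ℤ) →
      IsPole (G.operator q α).resolventSet (G.titchmarshWeyl q α G.boundary) (lam : ℂ)) ∧
    ∃ T : Matrix G.boundary G.boundary ℂ,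
      HasResidue (G.operator q α).resolventSet (G.titchmarshWeyl q α G.boundary) (lam : ℂ) T ∧
      (T.rank : ℤ) ≤ (Module.finrank ℂ ((G.operator q α).eigenspace (lam : ℂ)) : ℤ) ∧
      (Module.finrank ℂ ((G.operator q α).eigenspace (lam : ℂ)) : ℤ) ≤ T.rank + 2 * G.cyc - 1 := by
  classical
  obtain ⟨T, H, ε, hS, hle, hge⟩ :=
    MetricGraph.exists_simplePart_rank_bounds hconn hcyc hB hq α lam
  rw [LinearPMap.finrank_eigenvectors] at hle hge
  have hfin : FiniteDimensional ℂ ((G.operator q α).eigenspace (lam : ℂ)) :=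
    @Module.Finite.equiv _ _ _ _ _ _ _ _ (MetricGraph.finiteDimensional_eigenvectors hq)
      (Submodule.equivMapOfInjective _ (G.operator q α).domain.injective_subtype _).symm
  refine ⟨fun hpole hbot => hS.isPole_iff.1 hpole ?_, hfin, fun _ hlt => hS.isPole_iff.2 ?_,
    T, hS.hasResidue, by exact_mod_cast hle, hge⟩
  · rw [hbot, finrank_bot, Nat.le_zero] at hle
    have h0 : T.mulVecLin = 0 := LinearMap.range_eq_bot.1 (Submodule.finrank_eq_zero.1 hle)
    refine Matrix.ext_of_mulVec_single fun i => ?_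
    rw [Matrix.zero_mulVec]
    exact LinearMap.congr_fun h0 (Pi.single i 1)
  · rintro rfl
    rw [Matrix.rank_zero] at hge
    omega
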